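/- Let $E,J,R\in\mathbb C^{n\times n}$ with $E=E^H\ge 0$, $E\neq 0$, $R=R^H\ge 0$ and $J=-J^H$. Let $P$ be a unitary matrix such that $\check E=PEP^H$, $\check J=PJP^H$, $\check R=PRP^H$ are in staircase form, that is, partitioned with square diagonal blocks of sizes $n_1,n_2,n_3,n_4=n_1,n_5\in\mathbb N_0$, $$\check E=\begin{bmatrix}E_{11}&E_{21}^H&0&0&0\\E_{21}&E_{22}&0&0&0\\0&0&0&0&0\\0&0&0&0&0\\0&0&0&0&0\end{bmatrix},\quad \check J=\begin{bmatrix}J_{11}&-J_{21}^H&-J_{31}^H&-J_{41}^H&0\\J_{21}&J_{22}&-J_{32}^H&0&0\\J_{31}&J_{32}&J_{33}&0&0\\J_{41}&0&0&0&0\\0&0&0&0&0\end{bmatrix},\quad \check R=\begin{bmatrix}R_{11}&R_{21}^H&R_{31}^H&0&0\\R_{21}&R_{22}&R_{32}^H&0&0\\R_{31}&R_{32}&R_{33}&0&0\\0&0&0&0&0\\0&0&0&0&0\end{bmatrix},$$ with $\begin{bmatrix}E_{11}&E_{21}^H\\E_{21}&E_{22}\end{bmatrix}$ positive definite and $J_{41}$,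 $J_{33}-R_{33}$ invertible (conditions on empty blocks are void). Put $\check A=\check J-\check R$ with blocks $\check A_{ij}$, $\hat A_{22}=\check A_{22}-\check A_{23}\check A_{33}^{-1}\check A_{32}$, $\hat J_{22}=\tfrac12(\hat A_{22}-\hat A_{22}^H)$, $\hat R_{22}=-\tfrac12(\hat A_{22}+\hat A_{22}^H)$. A pencil $\lambda\hat E-\hat A$, partitioned in the same way, is in almost Kronecker canonical form with blocks $\hat E_{11},\hat E_{22},\hat A_{22}'$ if $\hat E=\mathrm{diag}(\hat E_{11},\hat E_{22},0,0,0)$ with $\hat E_{11},\hat E_{22}$ Hermitian positive definite and $$\hat A=\begin{bmatrix}0&0&0&I&0\\0&\hat A_{22}'&0&0&0\\0&0&I&0&0\\-I&0&0&0&0\\0&0&0&0&0\end{bmatrix}.$$ Solutions of DAEs are continuously differentiable functions on $[0,\infty)$. In terms of the Kronecker canonical form of a pencil, its DAE-index is the size of the largest block $\lambda\mathcal J_\sigma(0)-I_\sigma$ ($0$ if there is none), its finite eigenvalues are the numbers $\lambda_0$ of the blocks $\lambda I_\rho-\mathcal J_\rho(\lambda_0)$, and a finite eigenvalue is semi-simple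 if all its blocks have size $1$ (here $\mathcal J_k(\lambda_0)$ is the $k\times k$ Jordan block). Then: (P1) The pencil $\lambda E-(J-R)$ is regular if and only if $n_5=0$. (P2) If the pencil is regular, its (unique) DAE-index $\nu$ satisfies: $\nu=2$ iff $n_1=n_4>0$; $\nu=1$ iff $n_1=0$ and $n_3>0$; $\nu=0$ iff $n_1=0$ and $n_3=0$. (P3) A function $x$ solves $E\dot x=(J-R)x$ if and only if $y=Px$ solves $\check E\dot y=(\check J-\check R)y$. Whenever $L,Z$ are invertible and $\lambda L\check EZ-L\check AZ$ is in almost Kronecker canonical form with blocks $\hat E_{11},\hat E_{22},\hat A_{22}'$, $y$ solves the latter DAE if and only if $z=Z^{-1}y$ solves $L\check EZ\dot z=L\check AZz$, and, if $n_5=0$, $z$ solves this DAE if and only if $$z_1=0,\qquad \hat E_{22}\dot z_2=\hat A_{22}'z_2,\qquad z_3=0,\qquad z_4=0 .$$ There are invertible $L,Z$ giving an almost Kronecker canonical form with $\hat E_{11}=E_{11}-E_{21}^HE_{22}^{-1}E_{21}$, $\hat E_{22}=E_{22}$ and $\hat A_{22}'=\hat A_{22}$, and such that $y=Zz$ satisfies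 $y_2=z_2$ for every solution $z$. (P4) Let $n_5=0$. Then $y$ solves $\check E\dot y=(\check J-\check R)y$ if and only if $y_2$ solves the implicit ODE $E_{22}\dot y_2=(\hat J_{22}-\hat R_{22})y_2$ and $$y_1=0,\quad y_3=-\check A_{33}^{-1}\check A_{32}y_2,\quad y_4=J_{41}^{-H}\bigl((-J_{21}^H-R_{21}^H)y_2+(-J_{31}^H-R_{31}^H)y_3-E_{21}^H\dot y_2\bigr).$$ Irrespective of $n_5$, $E_{22}$ is Hermitian positive definite, $\hat A_{22}=\hat J_{22}-\hat R_{22}$, and $\hat A_{22}$ is semi-dissipative, i.e. its Hermitian part is negative semi-definite. (P5) The finite eigenvalues of $\lambda E-(J-R)$ are those of $\lambda E_{22}-\hat A_{22}$; if $n_5=0$, there is a constant $c\neq 0$ with $\det(\lambda E-(J-R))=c\,\det(\lambda E_{22}-\hat A_{22})$ for all $\lambda\in\mathbb C$. All finite eigenvalues lie in the closed left half-plane, and those on the imaginary axis are semi-simple. -/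

import Mathlib

open Matrix
open scoped ComplexOrder

/-! ### Kronecker canonical form of a matrix pencil `lam • E - A` -/

/-- The blocks of the Kronecker canonical form: right Kronecker blocks `L_k` (size `k × (k+1)`),
left Kronecker blocks `L_kᵀ` (size `(k+1) × k`), Jordan blocks `lam I - J_k(lam₀)` of a finite
eigenvalue `lam₀`, and blocks `lam J_k(0) - I` of the eigenvalue infinity. -/
inductive KroneckerBlock where
  | right (k : ℕ)
  | left (k : ℕ)
  | finite (k : ℕ) (lam₀ : ℂ)
  | infinite (k : ℕ)

/-- The upper triangular Jordan block `J_k(lam₀)`. -/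
def jordanBlock (k : ℕ) (lam₀ : ℂ) : Matrix (Fin k) (Fin k) ℂ :=
  Matrix.of fun i j => if j = i then lam₀ else if j.val = i.val + 1 then 1 else 0

/-- The `k × (k+1)` matrix `[I 0]`. -/
def kroneckerE (k : ℕ) : Matrix (Fin k) (Fin (k + 1)) ℂ :=
  Matrix.of fun i j => if j.val = i.val then 1 else 0

/-- The `k × (k+1)` matrix `[0 I]`. -/
def kroneckerA (k : ℕ) : Matrix (Fin k) (Fin (k + 1)) ℂ :=
  Matrix.of fun i j => if j.val = i.val + 1 then 1 else 0

namespace KroneckerBlock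

def rows : KroneckerBlock → ℕ
  | right k => k
  | left k => k + 1
  | finite k _ => k
  | infinite k => k

def cols : KroneckerBlock → ℕ
  | right k => k + 1
  | left k => k
  | finite k _ => k
  | infinite k => k

/-- The matrix `E` of the block pencil `lam • E - A`. -/
def matE : (b : KroneckerBlock) → Matrix (Fin b.rows) (Fin b.cols) ℂ
  | right k => kroneckerE k
  | left k => (kroneckerE k)ᵀ
  | finite k _ => (1 : Matrix (Fin k) (Fin k) ℂ)
  | infinite k => jordanBlock k 0

/-- The matrix `A` of the block pencil `lam • E - A`. -/
def matA : (b : KroneckerBlock) → Matrix (Fin b.rows) (Fin b.cols) ℂ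
  | right k => kroneckerA k
  | left k => (kroneckerA k)ᵀ
  | finite k lam₀ => jordanBlock k lam₀
  | infinite k => (1 : Matrix (Fin k) (Fin k) ℂ)

/-- The blocks belonging to finite eigenvalues and to infinity have positive size
(the rectangular blocks may have size `0 × 1` or `1 × 0`). -/
def IsProper : KroneckerBlock → Prop
  | right _ => True
  | left _ => True
  | finite k _ => 0 < k
  | infinite k => 0 < k

/-- The size of a block of the eigenvalue infinity, and `0` for all other blocks. -/
def infiniteSize : KroneckerBlock → ℕ
  | infinite k => k
  | _ => 0

end KroneckerBlock

/-- The family `b` of blocks is a Kronecker canonical form of the pencil `lam • E - A`: for some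
nonsingular `S`, `T`, the pencil `S (lam • E - A) T` is block diagonal with diagonal blocks `b`.
The bijections `r`, `c` number the rows and columns of the block diagonal matrix. -/
def IsKroneckerForm {ι : Type} [Fintype ι] [DecidableEq ι] (E A : Matrix ι ι ℂ)
    {m : ℕ} (b : Fin m → KroneckerBlock) : Prop :=
  (∀ k, (b k).IsProper) ∧
  ∃ (r : ι ≃ (Σ k, Fin (b k).rows)) (c : ι ≃ (Σ k, Fin (b k).cols)) (S T : Matrix ι ι ℂ),
    IsUnit S ∧ IsUnit T ∧
    S * E * T = (Matrix.blockDiagonal' fun k => (b k).matE).submatrix r c ∧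
    S * A * T = (Matrix.blockDiagonal' fun k => (b k).matA).submatrix r c

/-- The square pencil `lam • E - A` is regular. -/
def IsRegularPencil {ι : Type} [Fintype ι] [DecidableEq ι] (E A : Matrix ι ι ℂ) : Prop :=
  ∃ lam₀ : ℂ, (lam₀ • E - A).det ≠ 0

/-- `ν` is the DAE-index (Kronecker index) of the pencil `lam • E - A`: the size of the largest
block of the eigenvalue infinity in a Kronecker canonical form (`0` if there is no such block;
for a regular pencil this means that `E` is invertible). -/
def IsDAEIndex {ι : Type} [Fintype ι] [DecidableEq ι] (E A : Matrix ι ι ℂ) (ν : ℕ) : Prop :=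
  ∃ (m : ℕ) (b : Fin m → KroneckerBlock), IsKroneckerForm E A b ∧
    ν = Finset.univ.sup fun k => (b k).infiniteSize

/-- `lam₀` is a finite eigenvalue of the pencil `lam • E - A`. -/
def IsFiniteEigenvalue {ι : Type} [Fintype ι] [DecidableEq ι] (E A : Matrix ι ι ℂ)
    (lam₀ : ℂ) : Prop :=
  ∃ (m : ℕ) (b : Fin m → KroneckerBlock), IsKroneckerForm E A b ∧
    ∃ k s, b k = KroneckerBlock.finite s lam₀

/-- `lam₀` is a semi-simple finite eigenvalue of the pencil `lam • E - A`:
all its Jordan blocks have size one. -/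
def IsSemisimpleEigenvalue {ι : Type} [Fintype ι] [DecidableEq ι] (E A : Matrix ι ι ℂ)
    (lam₀ : ℂ) : Prop :=
  IsFiniteEigenvalue E A lam₀ ∧
  ∀ (m : ℕ) (b : Fin m → KroneckerBlock), IsKroneckerForm E A b →
    ∀ k s, b k = KroneckerBlock.finite s lam₀ → s = 1

/-! ### Semi-dissipative matrices and solutions of DAEs -/

/-- The Hermitian part of a matrix. -/
noncomputable def hermitianPart {ι : Type} (A : Matrix ι ι ℂ) : Matrix ι ι ℂ :=
  (1 / 2 : ℂ) • (A + Aᴴ)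

/-- The skew-Hermitian part of a matrix. -/
noncomputable def skewHermitianPart {ι : Type} (A : Matrix ι ι ℂ) : Matrix ι ι ℂ :=
  (1 / 2 : ℂ) • (A - Aᴴ)

/-- `A` is semi-dissipative: its Hermitian part is negative semi-definite. -/
def IsSemiDissipative {ι : Type} (A : Matrix ι ι ℂ) : Prop :=
  (-hermitianPart A).PosSemidef

/-- `x` is a (continuously differentiable) solution of `E x'(t) = A x(t)` on `[0, ∞)`. Only the
values of `x` on `[0, ∞)` matter; the derivative at `0` is one-sided. -/
def IsSolution {ι : Type} [Fintype ι] (E A : Matrix ι ι ℂ) (x : ℝ → ι → ℂ) : Prop :=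
  ContDiffOn ℝ 1 x (Set.Ici 0) ∧
  ∀ t : ℝ, 0 ≤ t → E *ᵥ derivWithin x (Set.Ici 0) t = A *ᵥ x t

/-! ### Five by five block matrices -/

/-- The index set of a vector that is partitioned into five blocks. -/
abbrev Blk (n₁ n₂ n₃ n₄ n₅ : ℕ) : Type := Fin n₁ ⊕ Fin n₂ ⊕ Fin n₃ ⊕ Fin n₄ ⊕ Fin n₅

namespace Blk

variable {n₁ n₂ n₃ n₄ n₅ : ℕ}

/-- The five block components of a partitioned vector. -/
def fst (v : Blk n₁ n₂ n₃ n₄ n₅ → ℂ) : Fin n₁ → ℂ := fun i => v (Sum.inl i)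
def snd (v : Blk n₁ n₂ n₃ n₄ n₅ → ℂ) : Fin n₂ → ℂ := fun i => v (Sum.inr (Sum.inl i))
def trd (v : Blk n₁ n₂ n₃ n₄ n₅ → ℂ) : Fin n₃ → ℂ := fun i => v (Sum.inr (Sum.inr (Sum.inl i)))
def fth (v : Blk n₁ n₂ n₃ n₄ n₅ → ℂ) : Fin n₄ → ℂ :=
  fun i => v (Sum.inr (Sum.inr (Sum.inr (Sum.inl i))))

end Blk

/-- A row of five blocks. -/
def blockRow {m n₁ n₂ n₃ n₄ n₅ : ℕ}
    (M₁ : Matrix (Fin m) (Fin n₁) ℂ) (M₂ : Matrix (Fin m) (Fin n₂) ℂ)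
    (M₃ : Matrix (Fin m) (Fin n₃) ℂ) (M₄ : Matrix (Fin m) (Fin n₄) ℂ)
    (M₅ : Matrix (Fin m) (Fin n₅) ℂ) : Matrix (Fin m) (Blk n₁ n₂ n₃ n₄ n₅) ℂ :=
  fromCols M₁ (fromCols M₂ (fromCols M₃ (fromCols M₄ M₅)))

/-- Five rows of blocks on top of each other. -/
def blockRows {n₁ n₂ n₃ n₄ n₅ : ℕ} {κ : Type}
    (M₁ : Matrix (Fin n₁) κ ℂ) (M₂ : Matrix (Fin n₂) κ ℂ) (M₃ : Matrix (Fin n₃) κ ℂ)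
    (M₄ : Matrix (Fin n₄) κ ℂ) (M₅ : Matrix (Fin n₅) κ ℂ) : Matrix (Blk n₁ n₂ n₃ n₄ n₅) κ ℂ :=
  fromRows M₁ (fromRows M₂ (fromRows M₃ (fromRows M₄ M₅)))

/-! ### Staircase form -/

/-- The blocks that occur in the staircase form of a triple `(E, J, R)`. The block sizes are
`n₁, n₂, n₃, n₄ = n₁, n₅`. -/
structure StaircaseBlocks (n₁ n₂ n₃ n₅ : ℕ) where
  E₁₁ : Matrix (Fin n₁) (Fin n₁) ℂ
  E₂₁ : Matrix (Fin n₂) (Fin n₁) ℂ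
  E₂₂ : Matrix (Fin n₂) (Fin n₂) ℂ
  J₁₁ : Matrix (Fin n₁) (Fin n₁) ℂ
  J₂₁ : Matrix (Fin n₂) (Fin n₁) ℂ
  J₂₂ : Matrix (Fin n₂) (Fin n₂) ℂ
  J₃₁ : Matrix (Fin n₃) (Fin n₁) ℂ
  J₃₂ : Matrix (Fin n₃) (Fin n₂) ℂ
  J₃₃ : Matrix (Fin n₃) (Fin n₃) ℂ
  J₄₁ : Matrix (Fin n₁) (Fin n₁) ℂ
  R₁₁ : Matrix (Fin n₁) (Fin n₁) ℂ
  R₂₁ : Matrix (Fin n₂) (Fin n₁) ℂ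
  R₂₂ : Matrix (Fin n₂) (Fin n₂) ℂ
  R₃₁ : Matrix (Fin n₃) (Fin n₁) ℂ
  R₃₂ : Matrix (Fin n₃) (Fin n₂) ℂ
  R₃₃ : Matrix (Fin n₃) (Fin n₃) ℂ

namespace StaircaseBlocks

variable {n₁ n₂ n₃ n₅ : ℕ} (B : StaircaseBlocks n₁ n₂ n₃ n₅)

/-- The staircase matrix `Ě`. -/
def E : Matrix (Blk n₁ n₂ n₃ n₁ n₅) (Blk n₁ n₂ n₃ n₁ n₅) ℂ :=
  blockRows
    (blockRow B.E₁₁ B.E₂₁ᴴ 0 0 0)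
    (blockRow B.E₂₁ B.E₂₂ 0 0 0)
    (blockRow 0 0 0 0 0)
    (blockRow 0 0 0 0 0)
    (blockRow 0 0 0 0 0)

/-- The staircase matrix `J̌`. -/
def J : Matrix (Blk n₁ n₂ n₃ n₁ n₅) (Blk n₁ n₂ n₃ n₁ n₅) ℂ :=
  blockRows
    (blockRow B.J₁₁ (-B.J₂₁ᴴ) (-B.J₃₁ᴴ) (-B.J₄₁ᴴ) 0)
    (blockRow B.J₂₁ B.J₂₂ (-B.J₃₂ᴴ) 0 0)
    (blockRow B.J₃₁ B.J₃₂ B.J₃₃ 0 0)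
    (blockRow B.J₄₁ 0 0 0 0)
    (blockRow 0 0 0 0 0)

/-- The staircase matrix `Ř`. -/
def R : Matrix (Blk n₁ n₂ n₃ n₁ n₅) (Blk n₁ n₂ n₃ n₁ n₅) ℂ :=
  blockRows
    (blockRow B.R₁₁ B.R₂₁ᴴ B.R₃₁ᴴ 0 0)
    (blockRow B.R₂₁ B.R₂₂ B.R₃₂ᴴ 0 0)
    (blockRow B.R₃₁ B.R₃₂ B.R₃₃ 0 0)
    (blockRow 0 0 0 0 0)
    (blockRow 0 0 0 0 0)

/-- Those blocks of `Ǎ = J̌ - Ř` that enter the reduced systems. -/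
def A₂₂ : Matrix (Fin n₂) (Fin n₂) ℂ := B.J₂₂ - B.R₂₂
def A₂₃ : Matrix (Fin n₂) (Fin n₃) ℂ := -B.J₃₂ᴴ - B.R₃₂ᴴ
def A₃₂ : Matrix (Fin n₃) (Fin n₂) ℂ := B.J₃₂ - B.R₃₂
def A₃₃ : Matrix (Fin n₃) (Fin n₃) ℂ := B.J₃₃ - B.R₃₃

/-- The Schur complement `Â₂₂ = Ǎ₂₂ - Ǎ₂₃ Ǎ₃₃⁻¹ Ǎ₃₂`, with its parts `Ĵ₂₂` and `R̂₂₂`. -/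
noncomputable def hatA₂₂ : Matrix (Fin n₂) (Fin n₂) ℂ := B.A₂₂ - B.A₂₃ * B.A₃₃⁻¹ * B.A₃₂
noncomputable def hatJ₂₂ : Matrix (Fin n₂) (Fin n₂) ℂ := skewHermitianPart B.hatA₂₂
noncomputable def hatR₂₂ : Matrix (Fin n₂) (Fin n₂) ℂ := -hermitianPart B.hatA₂₂

/-- The Schur complement `Ê₁₁ = E₁₁ - E₂₁ᴴ E₂₂⁻¹ E₂₁`. -/
noncomputable def hatE₁₁ : Matrix (Fin n₁) (Fin n₁) ℂ := B.E₁₁ - B.E₂₁ᴴ * B.E₂₂⁻¹ * B.E₂₁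

end StaircaseBlocks

/-- The triple `(E, J, R)` is in staircase form with blocks `B`. Conditions on a block of size
zero are void. -/
structure IsStaircaseForm {n₁ n₂ n₃ n₅ : ℕ}
    (E J R : Matrix (Blk n₁ n₂ n₃ n₁ n₅) (Blk n₁ n₂ n₃ n₁ n₅) ℂ)
    (B : StaircaseBlocks n₁ n₂ n₃ n₅) : Prop where
  eqE : E = B.E
  eqJ : J = B.J
  eqR : R = B.R
  posDef : (fromBlocks B.E₁₁ B.E₂₁ᴴ B.E₂₁ B.E₂₂).PosDef
  isUnit_J₄₁ : IsUnit B.J₄₁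
  isUnit_A₃₃ : IsUnit (B.J₃₃ - B.R₃₃)

/-- The pencil `lam • E - A` is in almost Kronecker canonical form with blocks
`Ê₁₁`, `Ê₂₂`, `Â₂₂`. -/
structure IsAlmostKroneckerForm {n₁ n₂ n₃ n₅ : ℕ}
    (E A : Matrix (Blk n₁ n₂ n₃ n₁ n₅) (Blk n₁ n₂ n₃ n₁ n₅) ℂ)
    (E₁₁ : Matrix (Fin n₁) (Fin n₁) ℂ) (E₂₂ A₂₂ : Matrix (Fin n₂) (Fin n₂) ℂ) : Prop where
  eqE : E = blockRows
    (blockRow E₁₁ 0 0 0 0)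
    (blockRow 0 E₂₂ 0 0 0)
    (blockRow 0 0 0 0 0)
    (blockRow 0 0 0 0 0)
    (blockRow 0 0 0 0 0)
  eqA : A = blockRows
    (blockRow 0 0 0 1 0)
    (blockRow 0 A₂₂ 0 0 0)
    (blockRow 0 0 1 0 0)
    (blockRow (-1) 0 0 0 0)
    (blockRow 0 0 0 0 0)
  posDef₁₁ : E₁₁.PosDef
  posDef₂₂ : E₂₂.PosDef

/-! ### Jordan normal form -/

section Jordan

open Polynomial

/-! One block elimination carries the whole theorem. Positive definiteness of the leading part of
`Ě` makes `E₂₂` invertible; together with the invertibility of `A₃₃` and `J₄₁` this gives explicit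
`L`, `Z` that bring the staircase pencil to almost Kronecker form
(`exists_almostKronecker_transform`). Once block 1 is paired with block 4, that form is a direct sum
of four pieces: the pair `[λÊ₁₁, -I; I, 0]`, whose determinant does not depend on `λ`; the pencil
`λE₂₂ - Â₂₂` with `E₂₂` invertible; the constant `-I`; and a zero pencil of size `n₅`. Regularity,
the determinant formula and the decoupled DAE follow from this splitting.

Kronecker forms exist because each piece has one: blocks of size two at infinity, the Jordan form of
`E₂₂⁻¹Â₂₂`, blocks of size one at infinity, and empty left and right blocks. Their uniqueness is
never used. Instead, blocks are detected by vector chains whose definition involves only `E` and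
`A`. For a regular pencil, an infinite block exists iff `E` has a kernel, and one of size at least
two exists iff `Ev = 0`, `Ew = Av` has a solution with `v ≠ 0`. A finite block yields `Av = λEv`
with `Ev ≠ 0`, and one of size at least two yields a further generalized eigenvector.

The dissipative structure enters by pairing these chains with their first vector
(`re_le_zero_of_eigenvector`, `not_exists_imaginary_chain`, `mulVec_eq_zero_of_infinite_chain`):
real parts of eigenvalues are nonpositive, imaginary eigenvalues have no chain of length two, and
infinity has none of length three. Semi-dissipativity of `Â₂₂` and positivity of `Ê₁₁` hold because
a Schur complement is a congruence `XᴴMX` with `X` chosen so that `MX` vanishes in the eliminated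
rows. -/

theorem sum_jordanBlock_smul {V : Type*} [AddCommGroup V] [Module ℂ V] {s : ℕ} (lam : ℂ)
    (v : Fin s → V) (j : Fin s) :
    ∑ i, jordanBlock s lam i j • v i
      = lam • v j + if h : 0 < j.val then v ⟨j.val - 1, by omega⟩ else 0 := by
  have h1 : ∀ i, jordanBlock s lam i j • v i
      = (if i = j then lam • v i else 0) + if j.val = i.val + 1 then v i else 0 := by
    intro i
    by_cases hij : i = j
    · subst hij; simp [jordanBlock]
    · have hji : ¬ j = i := fun h => hij h.symm
      simp [jordanBlock, hij, hji]
  simp only [h1, Finset.sum_add_distrib, Finset.sum_ite_eq', Finset.mem_univ, if_true]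
  congr 1
  split_ifs with h
  · rw [Finset.sum_eq_single (⟨j.val - 1, by omega⟩ : Fin s)]
    · rw [if_pos]; simp; omega
    · intro b _ hb
      rw [if_neg]
      intro hjb
      exact hb (Fin.ext (by simp; omega))
    · simp
  · exact Finset.sum_eq_zero fun i _ => if_neg (by omega)

/-- Over `ℂ` an irreducible `p` is a unit times `X - lam`, so the quotient has the powers of `X -
lam` below `e` as a basis, and multiplication by `X - lam` shifts them. -/
theorem exists_jordan_basis_quotient (p : ℂ[X]) (hp : Irreducible p) (e : ℕ) :
    ∃ (lam : ℂ) (b : Module.Basis (Fin e) ℂ (ℂ[X] ⧸ Submodule.span ℂ[X] {p ^ e})),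
      ∀ j, (X : ℂ[X]) • b j = ∑ i, jordanBlock e lam i j • b i := by
  have hdeg := IsAlgClosed.degree_eq_one_of_irreducible ℂ hp
  obtain ⟨lam, hlam⟩ := Polynomial.exists_root_of_degree_eq_one hdeg
  obtain ⟨q, hq⟩ := Polynomial.dvd_iff_isRoot.2 hlam
  have hp0 : p ≠ 0 := hp.ne_zero
  have hnd : p.natDegree = 1 := natDegree_eq_of_degree_eq_some hdeg
  have hq0 : q ≠ 0 := by rintro rfl; simp at hq; exact hp0 hq
  have hqd : q.natDegree = 0 := by
    have := congrArg natDegree hq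
    rw [natDegree_mul (X_sub_C_ne_zero _) hq0, natDegree_X_sub_C, hnd] at this
    omega
  obtain ⟨a, rfl⟩ : ∃ a, q = C a := ⟨_, eq_C_of_natDegree_eq_zero hqd⟩
  have ha : a ≠ 0 := by rintro rfl; simp at hq0
  let mk : ℂ[X] →ₗ[ℂ[X]] (ℂ[X] ⧸ Submodule.span ℂ[X] {p ^ e}) := Submodule.mkQ _
  have hmk : Function.Surjective mk := Submodule.mkQ_surjective _
  have hzero : ∀ k, e ≤ k → mk ((X - C lam) ^ k) = 0 := by
    intro k hk
    refine (Submodule.Quotient.mk_eq_zero _).2 (Ideal.mem_span_singleton.2 ?_)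
    refine dvd_trans ?_ (pow_dvd_pow _ hk)
    refine ⟨C (a⁻¹) ^ e, ?_⟩
    rw [hq, ← mul_pow, mul_assoc, ← C_mul, mul_inv_cancel₀ ha]
    simp
  -- The exponents decrease with `j`, so that `X - lam` sends `v j` to `v (j - 1)` and kills `v 0`:
  -- this is the upper triangular convention of `jordanBlock`.
  let v : Fin e → ℂ[X] ⧸ Submodule.span ℂ[X] {p ^ e} := fun j => mk ((X - C lam) ^ (e - 1 - j.val))
  have hspan : ⊤ ≤ Submodule.span ℂ (Set.range v) := by
    intro x _
    obtain ⟨f, rfl⟩ := hmk x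
    -- Taylor expansion at `lam` writes every class in powers of `X - lam`, of which those from `e`
    -- on vanish.
    rw [← Polynomial.sum_taylor_eq f lam, Polynomial.sum_def, map_sum]
    refine Submodule.sum_mem _ fun i _ => ?_
    rw [← smul_eq_C_mul, show mk ((taylor lam f).coeff i • (X - C lam) ^ i)
      = (taylor lam f).coeff i • mk ((X - C lam) ^ i) from rfl]
    refine Submodule.smul_mem _ _ ?_
    by_cases hi : i < e
    · refine Submodule.subset_span ⟨⟨e - 1 - i, by omega⟩, ?_⟩
      simp only [v]
      congr 2
      omega
    · rw [hzero i (by omega)]; exact Submodule.zero_mem _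
  have hfin : Fintype.card (Fin e) = Module.finrank ℂ (ℂ[X] ⧸ Submodule.span ℂ[X] {p ^ e}) := by
    have := finrank_quotient_span_eq_natDegree (K := ℂ) (f := p ^ e)
    rw [natDegree_pow, hnd, mul_one] at this
    rw [Fintype.card_fin]
    exact this.symm
  refine ⟨lam, basisOfTopLeSpanOfCardEqFinrank v hspan hfin, fun j => ?_⟩
  rw [coe_basisOfTopLeSpanOfCardEqFinrank, sum_jordanBlock_smul]
  have hX : (X : ℂ[X]) • v j = lam • v j + mk ((X - C lam) ^ (e - 1 - j.val + 1)) := by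
    have : lam • v j = mk (C lam * (X - C lam) ^ (e - 1 - j.val)) := by
      rw [← smul_eq_C_mul]; rfl
    rw [this, ← map_add, pow_succ, mul_comm _ (X - C lam), ← add_mul]
    simp only [v]
    rw [← map_smul, smul_eq_mul]
    congr 2
    ring
  rw [hX]
  congr 1
  split_ifs with h
  · simp only [v]
    congr 2
    omega
  · exact hzero _ (by omega)

/-- The matrix makes `ℂⁿ` a finitely generated torsion module over the principal ideal domain
`ℂ[X]`, with `X` acting as `M`; each primary cyclic summand contributes one Jordan block. -/
theorem exists_jordan_basis {n : ℕ} (M : Matrix (Fin n) (Fin n) ℂ) :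
    ∃ (κ : Type) (_ : Fintype κ) (_ : DecidableEq κ) (s : κ → ℕ) (lam : κ → ℂ)
      (B : Module.Basis (Σ k, Fin (s k)) ℂ (Fin n → ℂ)), (∀ k, 0 < s k) ∧
      ∀ k j, M *ᵥ B ⟨k, j⟩ = ∑ i, jordanBlock (s k) (lam k) i j • B ⟨k, i⟩ := by
  classical
  let φ : Module.End ℂ (Fin n → ℂ) := M.toLin'
  have htor : Module.IsTorsion ℂ[X] (Module.AEval' φ) := Module.AEval.isTorsion_of_finiteDimensional ℂ _ φ
  have hfin : Module.Finite ℂ[X] (Module.AEval' φ) := inferInstance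
  obtain ⟨κ, hκ, p, hp, e, ⟨l⟩⟩ := Module.equiv_directSum_of_isTorsion htor
  choose lam b hb using fun k => exists_jordan_basis_quotient (p k) (hp k) (e k)
  let l' : (Fin n → ℂ) ≃ₗ[ℂ] (Π₀ k, ℂ[X] ⧸ Submodule.span ℂ[X] {p k ^ e k}) :=
    (Module.AEval'.of φ).trans (l.restrictScalars ℂ)
  let B : Module.Basis (Σ k, Fin (e k)) ℂ (Fin n → ℂ) := (DFinsupp.basis b).map l'.symm
  have hB : ∀ k j, B ⟨k, j⟩ = l'.symm (DFinsupp.single k (b k j)) := fun k j => by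
    have : DFinsupp.basis b ⟨k, j⟩ = DFinsupp.single k (b k j) := by
      rw [Module.Basis.apply_eq_iff]
      change (sigmaFinsuppLequivDFinsupp ℂ).symm (DFinsupp.mapRange.linearEquiv
        (fun i => (b i).repr) (DFinsupp.single k (b k j))) = _
      rw [LinearEquiv.symm_apply_eq]
      simp
    simp [B, this]
  have hX : ∀ k j, M *ᵥ B ⟨k, j⟩ = l'.symm (DFinsupp.single k ((X : ℂ[X]) • b k j)) := by
    intro k j
    rw [LinearEquiv.eq_symm_apply]
    have h1 : l' (M *ᵥ B ⟨k, j⟩) = l ((X : ℂ[X]) • Module.AEval'.of φ (B ⟨k, j⟩)) := by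
      rw [Module.AEval'.X_smul_of]; rfl
    have h2 : l (Module.AEval'.of φ (B ⟨k, j⟩)) = DFinsupp.single k (b k j) := by
      have : l' (B ⟨k, j⟩) = DFinsupp.single k (b k j) := by rw [hB, LinearEquiv.apply_symm_apply]
      exact this
    rw [h1, map_smul, h2]
    exact (map_smul (DirectSum.lof ℂ[X] κ
      (fun k => ℂ[X] ⧸ Submodule.span ℂ[X] {p k ^ e k}) k) X (b k j)).symm
  -- Summands with exponent `0` are zero modules without basis vectors; they are dropped so that all
  -- block sizes are positive.
  let g : (Σ k, Fin (e k)) ≃ Σ k : {k // 0 < e k}, Fin (e k) :=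
    { toFun := fun x => ⟨⟨x.1, x.2.pos⟩, x.2⟩
      invFun := fun x => ⟨x.1.1, x.2⟩
      left_inv := fun _ => rfl
      right_inv := fun _ => rfl }
  refine ⟨{k // 0 < e k}, inferInstance, inferInstance, fun k => e k, fun k => lam k, B.reindex g,
    fun k => k.2, fun k j => ?_⟩
  simp only [Module.Basis.reindex_apply]
  change M *ᵥ B ⟨k.1, j⟩ = ∑ i, jordanBlock (e k) (lam k) i j • B ⟨k.1, i⟩
  rw [hX, hb]
  simp only [hB]
  simp only [← map_smul, ← DFinsupp.single_smul, ← map_sum]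
  congr 1
  exact map_sum (DFinsupp.singleAddHom _ k.1) _ _

end Jordan

/-! ### Assembling Kronecker canonical forms -/

section Assemble

variable {ι ι' κ κ' : Type} [Fintype ι] [DecidableEq ι] [Fintype ι'] [DecidableEq ι']
  [DecidableEq κ] [DecidableEq κ']

/-- The pencil `lam • E - A` is equivalent to the block diagonal pencil with blocks `b`, which may
be indexed by any finite type. -/
def HasKroneckerBlocks (E A : Matrix ι ι ℂ) (b : κ → KroneckerBlock) : Prop :=
  ∃ (r : ι ≃ (Σ k, Fin (b k).rows)) (c : ι ≃ (Σ k, Fin (b k).cols)) (S T : Matrix ι ι ℂ),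
    IsUnit S ∧ IsUnit T ∧
    S * E * T = (Matrix.blockDiagonal' fun k => (b k).matE).submatrix r c ∧
    S * A * T = (Matrix.blockDiagonal' fun k => (b k).matA).submatrix r c

theorem blockDiagonal'_submatrix_sigmaCongrLeft {m n : κ → ℕ}
    (M : ∀ k, Matrix (Fin (m k)) (Fin (n k)) ℂ) (g : κ' ≃ κ) :
    (blockDiagonal' M).submatrix (Equiv.sigmaCongrLeft (β := fun k => Fin (m k)) g)
      (Equiv.sigmaCongrLeft (β := fun k => Fin (n k)) g) = blockDiagonal' fun k => M (g k) := by
  ext ⟨k, i⟩ ⟨k', j⟩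
  by_cases h : k = k'
  · subst h
    simp [Equiv.sigmaCongrLeft, blockDiagonal'_apply_eq]
  · rw [blockDiagonal'_apply_ne (fun k => M (g k)) _ _ h]
    exact blockDiagonal'_apply_ne M _ _ fun h' => h (g.injective h')

theorem blockDiagonal'_submatrix_sumSigmaDistrib {m n : κ ⊕ κ' → ℕ}
    (M : ∀ k, Matrix (Fin (m k)) (Fin (n k)) ℂ) :
    (blockDiagonal' M).submatrix (Equiv.sumSigmaDistrib fun k => Fin (m k)).symm
      (Equiv.sumSigmaDistrib fun k => Fin (n k)).symm
      = fromBlocks (blockDiagonal' fun k => M (Sum.inl k)) 0 0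
        (blockDiagonal' fun k => M (Sum.inr k)) := by
  ext (⟨k, i⟩ | ⟨k, i⟩) (⟨k', j⟩ | ⟨k', j⟩)
  · by_cases h : k = k'
    · subst h
      simp [blockDiagonal'_apply_eq]
    · rw [fromBlocks_apply₁₁, blockDiagonal'_apply_ne (fun k => M (Sum.inl k)) _ _ h]
      exact blockDiagonal'_apply_ne M _ _ (by simpa using h)
  · exact blockDiagonal'_apply_ne M i j Sum.inl_ne_inr
  · exact blockDiagonal'_apply_ne M i j Sum.inr_ne_inl
  · by_cases h : k = k'
    · subst h
      simp [blockDiagonal'_apply_eq]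
    · rw [fromBlocks_apply₂₂, blockDiagonal'_apply_ne (fun k => M (Sum.inr k)) _ _ h]
      exact blockDiagonal'_apply_ne M _ _ (by simpa using h)

namespace HasKroneckerBlocks

variable {E A : Matrix ι ι ℂ} {b : κ → KroneckerBlock}

theorem comp_equiv (h : HasKroneckerBlocks E A b) (g : κ' ≃ κ) :
    HasKroneckerBlocks E A (b ∘ g) := by
  obtain ⟨r, c, S, T, hS, hT, hE, hA⟩ := h
  refine ⟨r.trans (Equiv.sigmaCongrLeft (β := fun k => Fin (b k).rows) g).symm,
    c.trans (Equiv.sigmaCongrLeft (β := fun k => Fin (b k).cols) g).symm, S, T, hS, hT, ?_, ?_⟩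
  · rw [hE]
    have := blockDiagonal'_submatrix_sigmaCongrLeft (fun k => (b k).matE) g
    change _ = (blockDiagonal' fun k => (b (g k)).matE).submatrix _ _
    rw [← this]
    ext i j
    simp
  · rw [hA]
    have := blockDiagonal'_submatrix_sigmaCongrLeft (fun k => (b k).matA) g
    change _ = (blockDiagonal' fun k => (b (g k)).matA).submatrix _ _
    rw [← this]
    ext i j
    simp

theorem isKroneckerForm [Fintype κ] (h : HasKroneckerBlocks E A b) (hb : ∀ k, (b k).IsProper) :
    IsKroneckerForm E A (b ∘ (Fintype.equivFin κ).symm) :=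
  ⟨fun _ => hb _, h.comp_equiv (Fintype.equivFin κ).symm⟩

theorem of_mul {L Z : Matrix ι ι ℂ} (hL : IsUnit L) (hZ : IsUnit Z)
    (h : HasKroneckerBlocks (L * E * Z) (L * A * Z) b) : HasKroneckerBlocks E A b := by
  obtain ⟨r, c, S, T, hS, hT, hE, hA⟩ := h
  refine ⟨r, c, S * L, Z * T, hS.mul hL, hZ.mul hT, ?_, ?_⟩
  · rw [← hE]; simp only [Matrix.mul_assoc]
  · rw [← hA]; simp only [Matrix.mul_assoc]

theorem of_submatrix (f g : ι' ≃ ι)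
    (h : HasKroneckerBlocks (E.submatrix f g) (A.submatrix f g) b) :
    HasKroneckerBlocks E A b := by
  obtain ⟨r, c, S, T, hS, hT, hE, hA⟩ := h
  have key : ∀ M : Matrix ι ι ℂ,
      S.submatrix f.symm f.symm * M * T.submatrix g.symm g.symm
        = (S * M.submatrix f g * T).submatrix f.symm g.symm := by
    intro M
    rw [← submatrix_mul_equiv _ _ _ g.symm, ← submatrix_mul_equiv _ _ _ f.symm]
    simp
  refine ⟨f.symm.trans r, g.symm.trans c, S.submatrix f.symm f.symm, T.submatrix g.symm g.symm,
    (isUnit_submatrix_equiv _ _).2 hS, (isUnit_submatrix_equiv _ _).2 hT, ?_, ?_⟩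
  · rw [key, hE]; rfl
  · rw [key, hA]; rfl

theorem fromBlocks {E' A' : Matrix ι' ι' ℂ} {b' : κ' → KroneckerBlock}
    (h : HasKroneckerBlocks E A b) (h' : HasKroneckerBlocks E' A' b') :
    HasKroneckerBlocks (Matrix.fromBlocks E 0 0 E') (Matrix.fromBlocks A 0 0 A')
      (Sum.elim b b') := by
  obtain ⟨r, c, S, T, hS, hT, hE, hA⟩ := h
  obtain ⟨r', c', S', T', hS', hT', hE', hA'⟩ := h'
  refine ⟨(Equiv.sumCongr r r').trans
      (Equiv.sumSigmaDistrib fun k => Fin (Sum.elim b b' k).rows).symm,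
    (Equiv.sumCongr c c').trans (Equiv.sumSigmaDistrib fun k => Fin (Sum.elim b b' k).cols).symm,
    Matrix.fromBlocks S 0 0 S', Matrix.fromBlocks T 0 0 T',
    isUnit_fromBlocks_zero₂₁.2 ⟨hS, hS'⟩, isUnit_fromBlocks_zero₂₁.2 ⟨hT, hT'⟩, ?_, ?_⟩
  · simp only [fromBlocks_multiply, Matrix.mul_zero, Matrix.zero_mul, add_zero, zero_add, hE, hE']
    have := blockDiagonal'_submatrix_sumSigmaDistrib fun k => (Sum.elim b b' k).matE
    refine Eq.trans ?_
      (congrArg (fun M => M.submatrix (Sum.map r r') (Sum.map c c')) this.symm)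
    ext (i | i) (j | j) <;> rfl
  · simp only [fromBlocks_multiply, Matrix.mul_zero, Matrix.zero_mul, add_zero, zero_add, hA, hA']
    have := blockDiagonal'_submatrix_sumSigmaDistrib fun k => (Sum.elim b b' k).matA
    refine Eq.trans ?_
      (congrArg (fun M => M.submatrix (Sum.map r r') (Sum.map c c')) this.symm)
    ext (i | i) (j | j) <;> rfl

end HasKroneckerBlocks

theorem exists_hasKroneckerBlocks_one {n : ℕ} (M : Matrix (Fin n) (Fin n) ℂ) :
    ∃ (κ : Type) (_ : Fintype κ) (_ : DecidableEq κ) (s : κ → ℕ) (lam : κ → ℂ),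
      (∀ k, 0 < s k) ∧
      HasKroneckerBlocks 1 M fun k => KroneckerBlock.finite (s k) (lam k) := by
  obtain ⟨κ, hκ, hd, s, lam, B, hs, hB⟩ := exists_jordan_basis M
  refine ⟨κ, hκ, hd, s, lam, hs, ?_⟩
  -- Two bases of the same space have equivalent index types; this fixes the numbering of the Jordan
  -- basis, whose vectors become the columns of `T`.
  let c : Fin n ≃ Σ k, Fin (s k) := (Pi.basisFun ℂ (Fin n)).indexEquiv B
  let B' : Module.Basis (Fin n) ℂ (Fin n → ℂ) := B.reindex c.symm
  let T : Matrix (Fin n) (Fin n) ℂ := (Pi.basisFun ℂ (Fin n)).toMatrix B'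
  have hT : IsUnit T := by
    have := (Pi.basisFun ℂ (Fin n)).invertibleToMatrix B'
    exact isUnit_of_invertible T
  have hTa : ∀ i j, T i j = B (c j) i := by
    intro i j
    simp [T, B', Module.Basis.toMatrix_apply]
  have hMT : M * T = T * (blockDiagonal' fun k => jordanBlock (s k) (lam k)).submatrix c c := by
    ext i j
    have h1 : (M * T) i j = (M *ᵥ B (c j)) i := by
      simp [Matrix.mul_apply, mulVec, dotProduct, hTa]
    obtain ⟨⟨k, a⟩, hj⟩ : ∃ x, c j = x := ⟨_, rfl⟩
    rw [h1, hj, hB, Matrix.mul_apply, ← c.symm.sum_comp, Fintype.sum_sigma,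
      Finset.sum_eq_single k]
    · simp [hTa, hj, blockDiagonal'_apply_eq, Finset.sum_apply, mul_comm]
    · intro k' _ hk
      refine Finset.sum_eq_zero fun a' _ => ?_
      simp [hTa, hj, blockDiagonal'_apply_ne _ _ _ hk]
    · simp
  have hdet : IsUnit T.det := (Matrix.isUnit_iff_isUnit_det _).1 hT
  refine ⟨c, c, T⁻¹, T, (isUnit_nonsing_inv_iff).2 hT, hT, ?_, ?_⟩
  · rw [Matrix.mul_one, Matrix.nonsing_inv_mul _ hdet]
    change _ = (blockDiagonal' (1 : ∀ k, Matrix (Fin (s k)) (Fin (s k)) ℂ)).submatrix c c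
    rw [blockDiagonal'_one, submatrix_one_equiv]
  · rw [Matrix.mul_assoc, hMT, Matrix.nonsing_inv_mul_cancel_left _ _ hdet]
    rfl

theorem exists_hasKroneckerBlocks_of_isUnit {n : ℕ} (E A : Matrix (Fin n) (Fin n) ℂ)
    (hE : IsUnit E) :
    ∃ (m : ℕ) (b : Fin m → KroneckerBlock), IsKroneckerForm E A b ∧
      ∀ k, ∃ s lam, b k = KroneckerBlock.finite s lam := by
  obtain ⟨κ, _, _, s, lam, hs, h⟩ := exists_hasKroneckerBlocks_one (E⁻¹ * A)
  have hdet : IsUnit E.det := (Matrix.isUnit_iff_isUnit_det _).1 hE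
  have h' : HasKroneckerBlocks E A fun k => KroneckerBlock.finite (s k) (lam k) := by
    refine HasKroneckerBlocks.of_mul (L := E⁻¹) (Z := 1) (isUnit_nonsing_inv_iff.2 hE)
      isUnit_one ?_
    rwa [Matrix.mul_one, Matrix.mul_one, Matrix.nonsing_inv_mul _ hdet]
  exact ⟨_, _, h'.isKroneckerForm hs, fun k => ⟨_, _, rfl⟩⟩

/-- Interleaving the two halves groups the `i`-th coordinate of each into one nilpotent `2 × 2`
Jordan block. -/
theorem hasKroneckerBlocks_infinite_two (m : ℕ) :
    HasKroneckerBlocks (fromBlocks 0 (1 : Matrix (Fin m) (Fin m) ℂ) 0 0) 1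
      (fun _ : Fin m => KroneckerBlock.infinite 2) := by
  let f : Fin m ⊕ Fin m ≃ Σ _ : Fin m, Fin 2 :=
    { toFun := Sum.elim (fun i => ⟨i, 0⟩) (fun i => ⟨i, 1⟩)
      invFun := fun x => if x.2 = 0 then Sum.inl x.1 else Sum.inr x.1
      left_inv := by rintro (i | i) <;> simp
      right_inv := by rintro ⟨k, i⟩; fin_cases i <;> simp }
  refine ⟨f, f, 1, 1, isUnit_one, isUnit_one, ?_, ?_⟩
  · rw [Matrix.one_mul, Matrix.mul_one]
    ext i j
    change _ = blockDiagonal' (fun _ : Fin m => jordanBlock 2 0) (f i) (f j)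
    rcases i with i | i <;> rcases j with j | j <;>
      by_cases hij : i = j <;>
      simp [f, blockDiagonal'_apply, jordanBlock, hij]
  · rw [Matrix.one_mul, Matrix.mul_one]
    change _ = (blockDiagonal' (1 : ∀ _ : Fin m, Matrix (Fin 2) (Fin 2) ℂ)).submatrix f f
    rw [blockDiagonal'_one, submatrix_one_equiv]

theorem hasKroneckerBlocks_infinite_one (m : ℕ) :
    HasKroneckerBlocks (0 : Matrix (Fin m) (Fin m) ℂ) 1
      (fun _ : Fin m => KroneckerBlock.infinite 1) := by
  let f : Fin m ≃ Σ _ : Fin m, Fin 1 := (Equiv.sigmaUnique (Fin m) fun _ => Fin 1).symm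
  refine ⟨f, f, 1, 1, isUnit_one, isUnit_one, ?_, ?_⟩
  · rw [Matrix.one_mul, Matrix.mul_one]
    ext i j
    change _ = blockDiagonal' (fun _ : Fin m => jordanBlock 1 0) (f i) (f j)
    by_cases hij : i = j <;> simp [f, blockDiagonal'_apply, jordanBlock, hij]
  · rw [Matrix.one_mul, Matrix.mul_one]
    change _ = (blockDiagonal' (1 : ∀ _ : Fin m, Matrix (Fin 1) (Fin 1) ℂ)).submatrix f f
    rw [blockDiagonal'_one, submatrix_one_equiv]

/-- A right block of size `0 × 1` is a zero column and a left block of size `1 × 0` is a zero row,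
so `m` of each make up the zero pencil. -/
theorem hasKroneckerBlocks_zero (m : ℕ) :
    HasKroneckerBlocks (0 : Matrix (Fin m) (Fin m) ℂ) 0
      (Sum.elim (fun _ : Fin m => KroneckerBlock.right 0)
        (fun _ : Fin m => KroneckerBlock.left 0)) := by
  let r : Fin m ≃ Σ k : Fin m ⊕ Fin m, Fin (Sum.elim (fun _ : Fin m => KroneckerBlock.right 0)
        (fun _ : Fin m => KroneckerBlock.left 0) k).rows :=
    { toFun := fun i => ⟨Sum.inr i, (0 : Fin 1)⟩
      invFun := fun x => match x with
        | ⟨Sum.inl _, a⟩ => Fin.elim0 a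
        | ⟨Sum.inr i, _⟩ => i
      left_inv := fun _ => rfl
      right_inv := by
        rintro ⟨i | i, a⟩
        · exact Fin.elim0 a
        · exact congrArg (Sigma.mk (Sum.inr i)) (Subsingleton.elim (α := Fin 1) _ _) }
  let c : Fin m ≃ Σ k : Fin m ⊕ Fin m, Fin (Sum.elim (fun _ : Fin m => KroneckerBlock.right 0)
        (fun _ : Fin m => KroneckerBlock.left 0) k).cols :=
    { toFun := fun i => ⟨Sum.inl i, (0 : Fin 1)⟩
      invFun := fun x => match x with
        | ⟨Sum.inl i, _⟩ => i
        | ⟨Sum.inr _, a⟩ => Fin.elim0 a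
      left_inv := fun _ => rfl
      right_inv := by
        rintro ⟨i | i, a⟩
        · exact congrArg (Sigma.mk (Sum.inl i)) (Subsingleton.elim (α := Fin 1) _ _)
        · exact Fin.elim0 a }
  refine ⟨r, c, 1, 1, isUnit_one, isUnit_one, ?_, ?_⟩
  · rw [Matrix.mul_zero, Matrix.zero_mul]
    ext i j
    exact (blockDiagonal'_apply_ne (fun k => (Sum.elim (fun _ : Fin m => KroneckerBlock.right 0)
      (fun _ : Fin m => KroneckerBlock.left 0) k).matE) (r i).2 (c j).2 Sum.inr_ne_inl).symm
  · rw [Matrix.mul_zero, Matrix.zero_mul]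
    ext i j
    exact (blockDiagonal'_apply_ne (fun k => (Sum.elim (fun _ : Fin m => KroneckerBlock.right 0)
      (fun _ : Fin m => KroneckerBlock.left 0) k).matA) (r i).2 (c j).2 Sum.inr_ne_inl).symm

end Assemble

/-! ### Reading off vectors and chains from a Kronecker canonical form -/

section Chains

theorem jordanBlock_mulVec_single_zero {s : ℕ} (lam : ℂ) (h : 0 < s) :
    jordanBlock s lam *ᵥ Pi.single ⟨0, h⟩ 1 = lam • Pi.single ⟨0, h⟩ 1 := by
  ext i
  simp only [mulVec_single_one, col_apply, jordanBlock, of_apply, Pi.smul_apply, Pi.single_apply,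
    smul_eq_mul, mul_ite, mul_one, mul_zero, Fin.ext_iff]
  split_ifs <;> first | contradiction | omega | simp

theorem jordanBlock_mulVec_single_succ {s : ℕ} (lam : ℂ) (j : ℕ) (h : j + 1 < s) :
    jordanBlock s lam *ᵥ Pi.single ⟨j + 1, h⟩ 1
      = lam • Pi.single ⟨j + 1, h⟩ 1 + Pi.single ⟨j, by omega⟩ 1 := by
  ext i
  simp only [mulVec_single_one, col_apply, jordanBlock, of_apply, Pi.smul_apply, Pi.single_apply,
    smul_eq_mul, mul_ite, mul_one, mul_zero, Pi.add_apply, Fin.ext_iff]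
  split_ifs <;> first | contradiction | omega | simp

namespace KroneckerBlock

theorem eq_zero_of_matE_mulVec (b : KroneckerBlock) (hr : ∀ k, b ≠ right k)
    (hi : ∀ k, b ≠ infinite k) (v : Fin b.cols → ℂ) (hv : b.matE *ᵥ v = 0) : v = 0 := by
  rcases b with k | k | ⟨k, lam⟩ | k
  · exact absurd rfl (hr k)
  · ext i
    have := congrFun hv i.castSucc
    change ∑ j, (if i.castSucc.val = j.val then (1 : ℂ) else 0) * v j = 0 at this
    rw [Finset.sum_eq_single i] at this
    · simpa using this
    · intro j _ hj
      rw [if_neg, zero_mul]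
      exact fun h => hj (Fin.ext h.symm)
    · simp
  · exact (one_mulVec (m := Fin k) v).symm.trans hv
  · exact absurd rfl (hi k)

/-- An infinite block of size at most one has `matE = 0` and `matA = 1`, so the chain equation
itself forces `v = 0`. On the other admissible blocks `matE` is injective. -/
theorem eq_zero_of_chain (b : KroneckerBlock) (hr : ∀ k, b ≠ right k)
    (hi : ∀ k, 2 ≤ k → b ≠ infinite k) (v w : Fin b.cols → ℂ) (hv : b.matE *ᵥ v = 0)
    (hw : b.matE *ᵥ w = b.matA *ᵥ v) : v = 0 := by
  by_cases h : ∃ k, b = infinite k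
  · obtain ⟨k, rfl⟩ := h
    have hk : k < 2 := by
      by_contra hk
      exact hi k (by omega) rfl
    have h0 : jordanBlock k 0 = 0 := by
      ext i j
      have hi := i.isLt
      have hj := j.isLt
      have : ¬ j.val = i.val + 1 := by omega
      simp [jordanBlock, this]
    have h1 : jordanBlock k 0 *ᵥ w = 0 := by
      rw [h0]
      exact zero_mulVec (n := Fin k) w
    exact (one_mulVec (m := Fin k) v).symm.trans (hw.symm.trans h1)
  · exact eq_zero_of_matE_mulVec b hr (fun k hk => h ⟨k, hk⟩) v hv

theorem exists_ker_right (b : KroneckerBlock) (k : ℕ) (hb : b = right k) (lam : ℂ) :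
    ∃ v : Fin b.cols → ℂ, v ≠ 0 ∧ b.matA *ᵥ v = lam • (b.matE *ᵥ v) := by
  subst hb
  -- The vector of powers `(1, lam, …, lam ^ k)` is annihilated by the block; its leading entry is
  -- `1` even for `lam = 0`.
  refine ⟨fun j => lam ^ j.val, ?_, ?_⟩
  · intro h
    have : lam ^ 0 = 0 := congrFun h (0 : Fin (k + 1))
    simp at this
  · ext i
    change ∑ j : Fin (k + 1), (if j.val = i.val + 1 then (1 : ℂ) else 0) * lam ^ j.val
      = lam * ∑ j : Fin (k + 1), (if j.val = i.val then (1 : ℂ) else 0) * lam ^ j.val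
    have hi : i.val < k := i.isLt
    rw [Finset.sum_eq_single (⟨i.val + 1, by omega⟩ : Fin (k + 1)),
      Finset.sum_eq_single (⟨i.val, by omega⟩ : Fin (k + 1))]
    · simp [pow_succ, mul_comm]
    · intro j _ hj
      rw [if_neg, zero_mul]
      exact fun h => hj (Fin.ext h)
    · simp
    · intro j _ hj
      rw [if_neg, zero_mul]
      exact fun h => hj (Fin.ext h)
    · simp

theorem exists_eigenvector (b : KroneckerBlock) {s : ℕ} {lam : ℂ} (hb : b = finite s lam)
    (hs : 0 < s) : ∃ v : Fin b.cols → ℂ, b.matE *ᵥ v ≠ 0 ∧ b.matA *ᵥ v = lam • (b.matE *ᵥ v) := by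
  subst hb
  suffices h : ∃ v : Fin s → ℂ, (1 : Matrix (Fin s) (Fin s) ℂ) *ᵥ v ≠ 0 ∧
      jordanBlock s lam *ᵥ v = lam • ((1 : Matrix (Fin s) (Fin s) ℂ) *ᵥ v) from h
  simp only [one_mulVec]
  exact ⟨Pi.single ⟨0, hs⟩ 1, by simp, jordanBlock_mulVec_single_zero _ _⟩

theorem exists_finite_chain (b : KroneckerBlock) {s : ℕ} {lam : ℂ} (hb : b = finite s lam)
    (hs : 2 ≤ s) : ∃ v w : Fin b.cols → ℂ, b.matE *ᵥ v ≠ 0 ∧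
      b.matA *ᵥ v = lam • (b.matE *ᵥ v) ∧ b.matA *ᵥ w = lam • (b.matE *ᵥ w) + b.matE *ᵥ v := by
  subst hb
  suffices h : ∃ v w : Fin s → ℂ, (1 : Matrix (Fin s) (Fin s) ℂ) *ᵥ v ≠ 0 ∧
      jordanBlock s lam *ᵥ v = lam • ((1 : Matrix (Fin s) (Fin s) ℂ) *ᵥ v) ∧
      jordanBlock s lam *ᵥ w = lam • ((1 : Matrix (Fin s) (Fin s) ℂ) *ᵥ w)
        + (1 : Matrix (Fin s) (Fin s) ℂ) *ᵥ v from h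
  simp only [one_mulVec]
  exact ⟨Pi.single ⟨0, by omega⟩ 1, Pi.single ⟨0 + 1, by omega⟩ 1, by simp,
    jordanBlock_mulVec_single_zero _ _, jordanBlock_mulVec_single_succ _ _ _⟩

theorem exists_infinite_ker (b : KroneckerBlock) {s : ℕ} (hb : b = infinite s) (hs : 0 < s) :
    ∃ v : Fin b.cols → ℂ, v ≠ 0 ∧ b.matE *ᵥ v = 0 := by
  subst hb
  suffices h : ∃ v : Fin s → ℂ, v ≠ 0 ∧ jordanBlock s 0 *ᵥ v = 0 from h
  refine ⟨Pi.single ⟨0, hs⟩ 1, by simp, ?_⟩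
  rw [jordanBlock_mulVec_single_zero, zero_smul]

theorem exists_infinite_chain_two (b : KroneckerBlock) {s : ℕ} (hb : b = infinite s)
    (hs : 2 ≤ s) : ∃ v w : Fin b.cols → ℂ, v ≠ 0 ∧ b.matE *ᵥ v = 0 ∧
      b.matE *ᵥ w = b.matA *ᵥ v := by
  subst hb
  suffices h : ∃ v w : Fin s → ℂ, v ≠ 0 ∧ jordanBlock s 0 *ᵥ v = 0 ∧
    jordanBlock s 0 *ᵥ w = (1 : Matrix (Fin s) (Fin s) ℂ) *ᵥ v from h
  refine ⟨Pi.single ⟨0, by omega⟩ 1, Pi.single ⟨0 + 1, by omega⟩ 1, by simp, ?_, ?_⟩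
  · rw [jordanBlock_mulVec_single_zero, zero_smul]
  · rw [jordanBlock_mulVec_single_succ, zero_smul, zero_add, one_mulVec]

theorem exists_infinite_chain_three (b : KroneckerBlock) {s : ℕ} (hb : b = infinite s)
    (hs : 3 ≤ s) : ∃ u v w : Fin b.cols → ℂ, b.matA *ᵥ u ≠ 0 ∧ b.matE *ᵥ u = 0 ∧
      b.matE *ᵥ v = b.matA *ᵥ u ∧ b.matE *ᵥ w = b.matA *ᵥ v := by
  subst hb
  suffices h : ∃ u v w : Fin s → ℂ, (1 : Matrix (Fin s) (Fin s) ℂ) *ᵥ u ≠ 0 ∧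
    jordanBlock s 0 *ᵥ u = 0 ∧
    jordanBlock s 0 *ᵥ v = (1 : Matrix (Fin s) (Fin s) ℂ) *ᵥ u ∧
    jordanBlock s 0 *ᵥ w = (1 : Matrix (Fin s) (Fin s) ℂ) *ᵥ v from h
  refine ⟨Pi.single ⟨0, by omega⟩ 1, Pi.single ⟨0 + 1, by omega⟩ 1, Pi.single ⟨1 + 1, by omega⟩ 1,
    by rw [one_mulVec]; simp, ?_, ?_, ?_⟩
  · rw [jordanBlock_mulVec_single_zero, zero_smul]
  · rw [jordanBlock_mulVec_single_succ, zero_smul, zero_add, one_mulVec]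
  · rw [jordanBlock_mulVec_single_succ, zero_smul, zero_add, one_mulVec]

end KroneckerBlock

theorem one_submatrix_sigma_mul {m : ℕ} {p q : Fin m → ℕ}
    (M : ∀ k, Matrix (Fin (p k)) (Fin (q k)) ℂ) (k : Fin m) :
    (1 : Matrix (Σ k, Fin (p k)) (Σ k, Fin (p k)) ℂ).submatrix id (Sigma.mk k) * M k
      = (blockDiagonal' M).submatrix id (Sigma.mk k) := by
  ext ⟨k', i⟩ j
  by_cases h : k' = k
  · subst h
    simp [Matrix.mul_apply, Matrix.one_apply, blockDiagonal'_apply_eq]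
  · have : ∀ x, ¬ (⟨k', i⟩ : Σ k, Fin (p k)) = ⟨k, x⟩ := fun x hx => h (congrArg Sigma.fst hx)
    simp [Matrix.mul_apply, blockDiagonal'_apply_ne M _ _ h, this]

theorem mul_one_submatrix_sigma {m : ℕ} {p q : Fin m → ℕ}
    (M : ∀ k, Matrix (Fin (p k)) (Fin (q k)) ℂ) (k : Fin m) :
    M k * (1 : Matrix (Σ k, Fin (q k)) (Σ k, Fin (q k)) ℂ).submatrix (Sigma.mk k) id
      = (blockDiagonal' M).submatrix (Sigma.mk k) id := by
  ext i ⟨k', j⟩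
  by_cases h : k = k'
  · subst h
    simp [Matrix.mul_apply, Matrix.one_apply, blockDiagonal'_apply_eq]
  · have : ∀ x, ¬ (⟨k, x⟩ : Σ k, Fin (q k)) = ⟨k', j⟩ := fun x hx => h (congrArg Sigma.fst hx)
    simp [Matrix.mul_apply, blockDiagonal'_apply_ne M _ _ h, this]

variable {ι : Type} [Fintype ι] [DecidableEq ι] {E A : Matrix ι ι ℂ} {m : ℕ}
  {b : Fin m → KroneckerBlock}

namespace IsKroneckerForm

/-- The column blocks of `T` and of `S⁻¹` carry vectors of a single block to vectors of the full
pencil, injectively, so chains in a block become chains for `E` and `A`. -/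
theorem exists_embeddings (h : IsKroneckerForm E A b) :
    ∃ (U : ∀ k, Matrix ι (Fin (b k).cols) ℂ) (V : ∀ k, Matrix ι (Fin (b k).rows) ℂ),
      (∀ k v, U k *ᵥ v = 0 → v = 0) ∧ (∀ k v, V k *ᵥ v = 0 → v = 0) ∧
      ∀ k, E * U k = V k * (b k).matE ∧ A * U k = V k * (b k).matA := by
  obtain ⟨-, r, c, S, T, hS, hT, hE, hA⟩ := h
  have hSd := (Matrix.isUnit_iff_isUnit_det _).1 hS
  have hinj : ∀ (N : Matrix ι ι ℂ), IsUnit N → ∀ v, N *ᵥ v = 0 → v = 0 := by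
    intro N hN v hv
    exact Matrix.mulVec_injective_iff_isUnit.2 hN (by rw [hv, mulVec_zero])
  have hsub : ∀ {n : Fin m → ℕ} (f : ι ≃ Σ k, Fin (n k)) (k : Fin m) (v : Fin (n k) → ℂ),
      (1 : Matrix (Σ k, Fin (n k)) (Σ k, Fin (n k)) ℂ).submatrix f (Sigma.mk k) *ᵥ v = 0 →
        v = 0 := by
    intro n f k v hv
    ext i
    have := congrFun hv (f.symm ⟨k, i⟩)
    simpa [mulVec, dotProduct, Matrix.one_apply] using this
  refine ⟨fun k => T * (1 : Matrix (Σ k, Fin (b k).cols) (Σ k, Fin (b k).cols) ℂ).submatrix c (Sigma.mk k),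
    fun k => S⁻¹ * (1 : Matrix (Σ k, Fin (b k).rows) (Σ k, Fin (b k).rows) ℂ).submatrix r (Sigma.mk k), ?_, ?_, fun k => ?_⟩
  · intro k v hv
    rw [← mulVec_mulVec] at hv
    exact hsub c k v (hinj T hT _ hv)
  · intro k v hv
    rw [← mulVec_mulVec] at hv
    exact hsub r k v (hinj S⁻¹ (isUnit_nonsing_inv_iff.2 hS) _ hv)
  · have key : ∀ (M : Matrix ι ι ℂ) (N : ∀ k, Matrix (Fin (b k).rows) (Fin (b k).cols) ℂ),
        S * M * T = (blockDiagonal' N).submatrix r c →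
        M * (T * (1 : Matrix (Σ k, Fin (b k).cols) (Σ k, Fin (b k).cols) ℂ).submatrix c (Sigma.mk k))
          = S⁻¹ * (1 : Matrix (Σ k, Fin (b k).rows) (Σ k, Fin (b k).rows) ℂ).submatrix r (Sigma.mk k) * N k := by
      intro M N hM
      have h1 : S * M * T * (1 : Matrix (Σ k, Fin (b k).cols) (Σ k, Fin (b k).cols) ℂ).submatrix c (Sigma.mk k)
          = (1 : Matrix (Σ k, Fin (b k).rows) (Σ k, Fin (b k).rows) ℂ).submatrix r (Sigma.mk k) * N k := by
        rw [hM, submatrix_mul_equiv, Matrix.mul_one]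
        have := congrArg (fun X => X.submatrix r id) (one_submatrix_sigma_mul N k)
        exact this.symm
      rw [Matrix.mul_assoc S⁻¹, ← h1]
      simp only [Matrix.mul_assoc]
      rw [Matrix.nonsing_inv_mul_cancel_left _ _ hSd]
    exact ⟨key _ _ hE, key _ _ hA⟩

/-- Dual to the embeddings: the row blocks of `T⁻¹` and `S` push a chain of the full pencil down to
every block, and a nonzero vector survives in at least one of them. -/
theorem exists_projections (h : IsKroneckerForm E A b) :
    ∃ (U : ∀ k, Matrix (Fin (b k).cols) ι ℂ) (V : ∀ k, Matrix (Fin (b k).rows) ι ℂ),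
      (∀ v, (∀ k, U k *ᵥ v = 0) → v = 0) ∧
      ∀ k, V k * E = (b k).matE * U k ∧ V k * A = (b k).matA * U k := by
  obtain ⟨-, r, c, S, T, hS, hT, hE, hA⟩ := h
  have hTd := (Matrix.isUnit_iff_isUnit_det _).1 hT
  refine ⟨fun k => (1 : Matrix (Σ k, Fin (b k).cols) (Σ k, Fin (b k).cols) ℂ).submatrix (Sigma.mk k) c * T⁻¹,
    fun k => (1 : Matrix (Σ k, Fin (b k).rows) (Σ k, Fin (b k).rows) ℂ).submatrix (Sigma.mk k) r * S, ?_, fun k => ?_⟩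
  · intro v hv
    have h0 : T⁻¹ *ᵥ v = 0 := by
      ext i
      have := congrFun (hv (c i).1) (c i).2
      rw [← mulVec_mulVec] at this
      simpa [mulVec, dotProduct, Matrix.one_apply, ← Equiv.symm_apply_eq] using this
    exact Matrix.mulVec_injective_iff_isUnit.2 (isUnit_nonsing_inv_iff.2 hT)
      (by rw [h0, mulVec_zero])
  · have key : ∀ (M : Matrix ι ι ℂ) (N : ∀ k, Matrix (Fin (b k).rows) (Fin (b k).cols) ℂ),
        S * M * T = (blockDiagonal' N).submatrix r c →
        (1 : Matrix (Σ k, Fin (b k).rows) (Σ k, Fin (b k).rows) ℂ).submatrix (Sigma.mk k) r * S * M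
          = N k * ((1 : Matrix (Σ k, Fin (b k).cols) (Σ k, Fin (b k).cols) ℂ).submatrix (Sigma.mk k) c * T⁻¹) := by
      intro M N hM
      have h1 : (1 : Matrix (Σ k, Fin (b k).rows) (Σ k, Fin (b k).rows) ℂ).submatrix (Sigma.mk k) r * (S * M * T)
          = N k * (1 : Matrix (Σ k, Fin (b k).cols) (Σ k, Fin (b k).cols) ℂ).submatrix (Sigma.mk k) c := by
        rw [hM, submatrix_mul_equiv, Matrix.one_mul]
        have := congrArg (fun X => X.submatrix id c) (mul_one_submatrix_sigma N k)
        exact this.symm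
      rw [← Matrix.mul_assoc, ← h1, ← Matrix.mul_assoc, Matrix.mul_nonsing_inv_cancel_right _ _ hTd,
        Matrix.mul_assoc]
    exact ⟨key _ _ hE, key _ _ hA⟩

/-- A right block has a kernel vector at every `lam`, which would make `det (lam • E - A)` vanish
identically. -/
theorem ne_right (h : IsKroneckerForm E A b) (hreg : IsRegularPencil E A) (k : Fin m) (s : ℕ) :
    b k ≠ KroneckerBlock.right s := by
  intro hk
  obtain ⟨lam, hlam⟩ := hreg
  obtain ⟨U, V, hU, -, hUV⟩ := h.exists_embeddings
  obtain ⟨v, hv, hAv⟩ := (b k).exists_ker_right s hk lam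
  refine hlam (Matrix.exists_mulVec_eq_zero_iff.1 ⟨U k *ᵥ v, fun h0 => hv (hU k v h0), ?_⟩)
  rw [sub_mulVec, smul_mulVec, mulVec_mulVec, mulVec_mulVec, (hUV k).1, (hUV k).2,
    ← mulVec_mulVec, ← mulVec_mulVec, hAv, mulVec_smul, sub_self]

/-- The condition `E *ᵥ v ≠ 0`, rather than `v ≠ 0`, is needed for singular pencils: a common kernel
vector of `E` and `A` satisfies the eigenvalue equation for every `lam`. -/
theorem exists_eigenvector (h : IsKroneckerForm E A b) {k : Fin m} {s : ℕ} {lam : ℂ}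
    (hk : b k = KroneckerBlock.finite s lam) :
    ∃ v, E *ᵥ v ≠ 0 ∧ A *ᵥ v = lam • (E *ᵥ v) := by
  obtain ⟨U, V, -, hV, hUV⟩ := h.exists_embeddings
  have hs : 0 < s := by have := h.1 k; rwa [hk] at this
  obtain ⟨v, hv, hAv⟩ := (b k).exists_eigenvector hk hs
  refine ⟨U k *ᵥ v, ?_, ?_⟩
  · rw [mulVec_mulVec, (hUV k).1, ← mulVec_mulVec]
    exact fun h0 => hv (hV k _ h0)
  · rw [mulVec_mulVec, mulVec_mulVec, (hUV k).1, (hUV k).2, ← mulVec_mulVec, ← mulVec_mulVec,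
      hAv, mulVec_smul]

theorem exists_finite_chain (h : IsKroneckerForm E A b) {k : Fin m} {s : ℕ} {lam : ℂ}
    (hk : b k = KroneckerBlock.finite s lam) (hs : 2 ≤ s) :
    ∃ v w, E *ᵥ v ≠ 0 ∧ A *ᵥ v = lam • (E *ᵥ v) ∧ A *ᵥ w = lam • (E *ᵥ w) + E *ᵥ v := by
  obtain ⟨U, V, -, hV, hUV⟩ := h.exists_embeddings
  obtain ⟨v, w, hv, hAv, hAw⟩ := (b k).exists_finite_chain hk hs
  refine ⟨U k *ᵥ v, U k *ᵥ w, ?_, ?_, ?_⟩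
  · rw [mulVec_mulVec, (hUV k).1, ← mulVec_mulVec]
    exact fun h0 => hv (hV k _ h0)
  · simp only [mulVec_mulVec, (hUV k).1, (hUV k).2]
    simp only [← mulVec_mulVec, hAv, mulVec_smul]
  · simp only [mulVec_mulVec, (hUV k).1, (hUV k).2]
    simp only [← mulVec_mulVec, hAw, mulVec_smul, mulVec_add]

theorem exists_ker (h : IsKroneckerForm E A b) {k : Fin m} {s : ℕ}
    (hk : b k = KroneckerBlock.infinite s) : ∃ v, v ≠ 0 ∧ E *ᵥ v = 0 := by
  obtain ⟨U, V, hU, -, hUV⟩ := h.exists_embeddings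
  have hs : 0 < s := by have := h.1 k; rwa [hk] at this
  obtain ⟨v, hv, hEv⟩ := (b k).exists_infinite_ker hk hs
  refine ⟨U k *ᵥ v, fun h0 => hv (hU k v h0), ?_⟩
  rw [mulVec_mulVec, (hUV k).1, ← mulVec_mulVec, hEv, mulVec_zero]

theorem exists_infinite_chain_two (h : IsKroneckerForm E A b) {k : Fin m} {s : ℕ}
    (hk : b k = KroneckerBlock.infinite s) (hs : 2 ≤ s) :
    ∃ v w, v ≠ 0 ∧ E *ᵥ v = 0 ∧ E *ᵥ w = A *ᵥ v := by
  obtain ⟨U, V, hU, -, hUV⟩ := h.exists_embeddings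
  obtain ⟨v, w, hv, hEv, hEw⟩ := (b k).exists_infinite_chain_two hk hs
  refine ⟨U k *ᵥ v, U k *ᵥ w, fun h0 => hv (hU k v h0), ?_, ?_⟩
  · rw [mulVec_mulVec, (hUV k).1, ← mulVec_mulVec, hEv, mulVec_zero]
  · simp only [mulVec_mulVec, (hUV k).1, (hUV k).2]
    simp only [← mulVec_mulVec, hEw]

theorem exists_infinite_chain_three (h : IsKroneckerForm E A b) {k : Fin m} {s : ℕ}
    (hk : b k = KroneckerBlock.infinite s) (hs : 3 ≤ s) :
    ∃ u v w, A *ᵥ u ≠ 0 ∧ E *ᵥ u = 0 ∧ E *ᵥ v = A *ᵥ u ∧ E *ᵥ w = A *ᵥ v := by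
  obtain ⟨U, V, -, hV, hUV⟩ := h.exists_embeddings
  obtain ⟨u, v, w, hu, hEu, hEv, hEw⟩ := (b k).exists_infinite_chain_three hk hs
  refine ⟨U k *ᵥ u, U k *ᵥ v, U k *ᵥ w, ?_, ?_, ?_, ?_⟩
  · rw [mulVec_mulVec, (hUV k).2, ← mulVec_mulVec]
    exact fun h0 => hu (hV k _ h0)
  · rw [mulVec_mulVec, (hUV k).1, ← mulVec_mulVec, hEu, mulVec_zero]
  · simp only [mulVec_mulVec, (hUV k).1, (hUV k).2]
    simp only [← mulVec_mulVec, hEv]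
  · simp only [mulVec_mulVec, (hUV k).1, (hUV k).2]
    simp only [← mulVec_mulVec, hEw]

theorem exists_infinite_of_ker (h : IsKroneckerForm E A b) (hreg : IsRegularPencil E A)
    {v : ι → ℂ} (hv : v ≠ 0) (hEv : E *ᵥ v = 0) : ∃ k s, b k = KroneckerBlock.infinite s := by
  obtain ⟨U, V, hU, hUV⟩ := h.exists_projections
  by_contra! hcon
  refine hv (hU v fun k => (b k).eq_zero_of_matE_mulVec (h.ne_right hreg k) (hcon k) _ ?_)
  rw [mulVec_mulVec, ← (hUV k).1, ← mulVec_mulVec, hEv, mulVec_zero]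

theorem exists_infinite_of_chain (h : IsKroneckerForm E A b) (hreg : IsRegularPencil E A)
    {v w : ι → ℂ} (hv : v ≠ 0) (hEv : E *ᵥ v = 0) (hEw : E *ᵥ w = A *ᵥ v) :
    ∃ k s, 2 ≤ s ∧ b k = KroneckerBlock.infinite s := by
  obtain ⟨U, V, hU, hUV⟩ := h.exists_projections
  by_contra! hcon
  refine hv (hU v fun k => (b k).eq_zero_of_chain (h.ne_right hreg k) (hcon k) _ (U k *ᵥ w) ?_ ?_)
  · rw [mulVec_mulVec, ← (hUV k).1, ← mulVec_mulVec, hEv, mulVec_zero]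
  · rw [mulVec_mulVec, mulVec_mulVec, ← (hUV k).1, ← (hUV k).2, ← mulVec_mulVec, hEw,
      mulVec_mulVec]

theorem le_sup_infiniteSize_iff {b : Fin m → KroneckerBlock} {d : ℕ} (hd : 0 < d) :
    d ≤ (Finset.univ.sup fun k => (b k).infiniteSize) ↔
      ∃ k s, d ≤ s ∧ b k = KroneckerBlock.infinite s := by
  rw [Finset.le_sup_iff hd]
  constructor
  · rintro ⟨k, -, hk⟩
    cases hb : b k with
    | infinite s => exact ⟨k, s, by rwa [hb] at hk, hb⟩
    | right s => rw [hb] at hk; exact absurd hk (by simp [KroneckerBlock.infiniteSize]; omega)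
    | left s => rw [hb] at hk; exact absurd hk (by simp [KroneckerBlock.infiniteSize]; omega)
    | finite s l => rw [hb] at hk; exact absurd hk (by simp [KroneckerBlock.infiniteSize]; omega)
  · rintro ⟨k, s, hs, hk⟩
    exact ⟨k, Finset.mem_univ _, by rw [hk]; exact hs⟩

end IsKroneckerForm

/-! ### The index in terms of chains at infinity -/

namespace IsDAEIndex

variable {ν : ℕ}

/-- The right-hand side does not mention a Kronecker form, so this criterion, with its analogue at
`2`, gives uniqueness of the index once `ν ≤ 2` is known. -/
theorem one_le_iff (h : IsDAEIndex E A ν) (hreg : IsRegularPencil E A) :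
    1 ≤ ν ↔ ∃ v, v ≠ 0 ∧ E *ᵥ v = 0 := by
  obtain ⟨m, b, hb, rfl⟩ := h
  rw [IsKroneckerForm.le_sup_infiniteSize_iff one_pos]
  constructor
  · rintro ⟨k, s, -, hk⟩
    exact hb.exists_ker hk
  · rintro ⟨v, hv, hEv⟩
    obtain ⟨k, s, hk⟩ := hb.exists_infinite_of_ker hreg hv hEv
    have hs : 0 < s := by have := hb.1 k; rwa [hk] at this
    exact ⟨k, s, hs, hk⟩

theorem two_le_iff (h : IsDAEIndex E A ν) (hreg : IsRegularPencil E A) :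
    2 ≤ ν ↔ ∃ v w, v ≠ 0 ∧ E *ᵥ v = 0 ∧ E *ᵥ w = A *ᵥ v := by
  obtain ⟨m, b, hb, rfl⟩ := h
  rw [IsKroneckerForm.le_sup_infiniteSize_iff two_pos]
  constructor
  · rintro ⟨k, s, hs, hk⟩
    exact hb.exists_infinite_chain_two hk hs
  · rintro ⟨v, w, hv, hEv, hEw⟩
    exact hb.exists_infinite_of_chain hreg hv hEv hEw

theorem exists_chain_three (h : IsDAEIndex E A ν) (hν : 3 ≤ ν) :
    ∃ u v w, A *ᵥ u ≠ 0 ∧ E *ᵥ u = 0 ∧ E *ᵥ v = A *ᵥ u ∧ E *ᵥ w = A *ᵥ v := by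
  obtain ⟨m, b, hb, rfl⟩ := h
  obtain ⟨k, s, hs, hk⟩ := (IsKroneckerForm.le_sup_infiniteSize_iff three_pos).1 hν
  exact hb.exists_infinite_chain_three hk hs

end IsDAEIndex

end Chains

/-! ### Dissipative Hamiltonian pencils -/

section Dissipative

variable {ι : Type} [Fintype ι]

theorem star_dotProduct_mulVec_star (M : Matrix ι ι ℂ) (x y : ι → ℂ) :
    star (star x ⬝ᵥ M *ᵥ y) = star y ⬝ᵥ Mᴴ *ᵥ x := by
  rw [← star_dotProduct, star_mulVec, dotProduct_mulVec]

variable {E J R : Matrix ι ι ℂ}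

theorem re_star_dotProduct_skew (hJ : Jᴴ = -J) (x : ι → ℂ) : (star x ⬝ᵥ J *ᵥ x).re = 0 := by
  have h := congrArg Complex.re (star_dotProduct_mulVec_star J x x)
  rw [hJ, neg_mulVec, dotProduct_neg] at h
  simp only [Complex.star_def, Complex.conj_re, Complex.neg_re] at h
  linarith

/-- Pairing with `v` and taking real parts gives `-vᴴRv = Re(lam) · vᴴEv` with `vᴴEv > 0`; in the
imaginary case `vᴴRv = 0`, hence `Rv = 0`. -/
theorem re_le_zero_of_eigenvector (hE : E.PosSemidef) (hR : R.PosSemidef) (hJ : Jᴴ = -J)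
    {lam : ℂ} {v : ι → ℂ} (hv : E *ᵥ v ≠ 0) (h : (J - R) *ᵥ v = lam • (E *ᵥ v)) :
    lam.re ≤ 0 ∧ (lam.re = 0 → R *ᵥ v = 0) := by
  have h1 := congrArg (fun w => (star v ⬝ᵥ w).re) h
  simp only [sub_mulVec, dotProduct_sub, Complex.sub_re, re_star_dotProduct_skew hJ,
    dotProduct_smul, smul_eq_mul, Complex.mul_re] at h1
  have hE0 := hE.dotProduct_mulVec_nonneg v
  have hR0 := hR.dotProduct_mulVec_nonneg v
  have hEne : star v ⬝ᵥ E *ᵥ v ≠ 0 := fun h0 => hv ((hE.dotProduct_mulVec_zero_iff v).1 h0)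
  obtain ⟨hEr, hEi⟩ := Complex.le_def.1 hE0
  obtain ⟨hRr, hRi⟩ := Complex.le_def.1 hR0
  simp only [Complex.zero_re, Complex.zero_im] at hEr hEi hRr hRi
  have hpos : 0 < (star v ⬝ᵥ E *ᵥ v).re := by
    refine lt_of_le_of_ne hEr fun h0 => hEne (Complex.ext h0.symm hEi.symm)
  rw [← hEi] at h1
  constructor
  · nlinarith
  · intro h0
    rw [h0] at h1
    refine (hR.dotProduct_mulVec_zero_iff v).1 (Complex.ext ?_ hRi.symm)
    simp only [Complex.zero_re]
    linarith

/-- Here `Rv = 0` and `Jv = lam Ev` with `lam` imaginary, so `vᴴ(J - R)w = lam vᴴEw`. Pairing the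
chain equation with `v` then leaves `vᴴEv = 0`, which contradicts `Ev ≠ 0`. -/
theorem not_exists_imaginary_chain (hE : E.PosSemidef) (hR : R.PosSemidef) (hJ : Jᴴ = -J)
    {lam : ℂ} (hlam : lam.re = 0) {v w : ι → ℂ} (hv : E *ᵥ v ≠ 0)
    (h : (J - R) *ᵥ v = lam • (E *ᵥ v)) :
    (J - R) *ᵥ w ≠ lam • (E *ᵥ w) + E *ᵥ v := by
  intro hw
  have hRv := (re_le_zero_of_eigenvector hE hR hJ hv h).2 hlam
  have hJv : J *ᵥ v = lam • (E *ᵥ v) := by rw [← h, sub_mulVec, hRv, sub_zero]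
  have hconj : star lam = -lam := Complex.ext (by simp [hlam]) (by simp)
  have hJ' : star v ⬝ᵥ J *ᵥ w = lam * (star v ⬝ᵥ E *ᵥ w) := by
    have h1 := star_dotProduct_mulVec_star J w v
    rw [hJv, dotProduct_smul, smul_eq_mul, star_mul', hconj, star_dotProduct_mulVec_star,
      hE.isHermitian.eq, hJ, neg_mulVec, dotProduct_neg] at h1
    linear_combination h1
  have hR' : star v ⬝ᵥ R *ᵥ w = 0 := by
    have h1 := star_dotProduct_mulVec_star R w v
    rw [hRv, dotProduct_zero, star_zero, hR.isHermitian.eq] at h1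
    exact h1.symm
  have h2 := congrArg (fun x => star v ⬝ᵥ x) hw
  simp only [sub_mulVec, dotProduct_sub, dotProduct_add, dotProduct_smul, smul_eq_mul, hJ', hR']
    at h2
  refine hv ((hE.dotProduct_mulVec_zero_iff v).1 ?_)
  linear_combination -h2

/-- Since `uᴴE = 0`, pairing the second equation with `u` gives `uᴴRu = 0`, so `Ru = 0` and `Ev =
Ju`. Pairing the third with `u` gives `uᴴJv = 0`, that is, `vᴴEv = 0`, so `Ev = 0`. -/
theorem mulVec_eq_zero_of_infinite_chain (hE : E.PosSemidef) (hR : R.PosSemidef) (hJ : Jᴴ = -J)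
    {u v w : ι → ℂ} (hu : E *ᵥ u = 0) (hv : E *ᵥ v = (J - R) *ᵥ u)
    (hw : E *ᵥ w = (J - R) *ᵥ v) : (J - R) *ᵥ u = 0 := by
  have hEu : ∀ x, star u ⬝ᵥ E *ᵥ x = 0 := by
    intro x
    have h1 := star_dotProduct_mulVec_star E x u
    rw [hu, dotProduct_zero, star_zero, hE.isHermitian.eq] at h1
    exact h1.symm
  have hRu : R *ᵥ u = 0 := by
    have h1 := congrArg (fun x => star u ⬝ᵥ x) hv
    simp only [hEu, sub_mulVec, dotProduct_sub] at h1
    refine (hR.dotProduct_mulVec_zero_iff u).1 ?_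
    have h2 := congrArg Complex.re h1
    simp only [Complex.sub_re, re_star_dotProduct_skew hJ, Complex.zero_re] at h2
    have h3 := (Complex.le_def.1 (hR.dotProduct_mulVec_nonneg u)).2
    refine Complex.ext ?_ h3.symm
    simp only [Complex.zero_re]
    linarith
  have hJu : E *ᵥ v = J *ᵥ u := by rw [hv, sub_mulVec, hRu, sub_zero]
  have hRv : star u ⬝ᵥ R *ᵥ v = 0 := by
    have h1 := star_dotProduct_mulVec_star R v u
    rw [hRu, dotProduct_zero, star_zero, hR.isHermitian.eq] at h1
    exact h1.symm
  have hJv : star u ⬝ᵥ J *ᵥ v = 0 := by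
    have h1 := congrArg (fun x => star u ⬝ᵥ x) hw
    simp only [hEu, sub_mulVec, dotProduct_sub, hRv, sub_zero] at h1
    exact h1.symm
  have h4 := star_dotProduct_mulVec_star J u v
  rw [hJv, star_zero, hJ, neg_mulVec, dotProduct_neg, ← hJu, eq_comm, neg_eq_zero] at h4
  rw [← hv]
  exact (hE.dotProduct_mulVec_zero_iff v).1 h4

end Dissipative

/-! ### Blocks of dissipative Hamiltonian pencils -/

namespace IsKroneckerForm

variable {ι : Type} [Fintype ι] [DecidableEq ι] {E J R : Matrix ι ι ℂ} {m : ℕ}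
  {b : Fin m → KroneckerBlock}

theorem re_le_zero (hE : E.PosSemidef) (hR : R.PosSemidef) (hJ : Jᴴ = -J)
    (h : IsKroneckerForm E (J - R) b) {k : Fin m} {s : ℕ} {lam : ℂ}
    (hk : b k = KroneckerBlock.finite s lam) : lam.re ≤ 0 := by
  obtain ⟨v, hv, hA⟩ := h.exists_eigenvector hk
  exact (re_le_zero_of_eigenvector hE hR hJ hv hA).1

theorem size_eq_one (hE : E.PosSemidef) (hR : R.PosSemidef) (hJ : Jᴴ = -J)
    (h : IsKroneckerForm E (J - R) b) {k : Fin m} {s : ℕ} {lam : ℂ} (hlam : lam.re = 0)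
    (hk : b k = KroneckerBlock.finite s lam) : s = 1 := by
  have hs : 0 < s := by have := h.1 k; rwa [hk] at this
  by_contra hs1
  obtain ⟨v, w, hv, hAv, hAw⟩ := h.exists_finite_chain hk (by omega)
  exact not_exists_imaginary_chain hE hR hJ hlam hv hAv hAw

end IsKroneckerForm

theorem IsDAEIndex.le_two {ι : Type} [Fintype ι] [DecidableEq ι] {E J R : Matrix ι ι ℂ}
    (hE : E.PosSemidef) (hR : R.PosSemidef) (hJ : Jᴴ = -J) {ν : ℕ}
    (h : IsDAEIndex E (J - R) ν) : ν ≤ 2 := by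
  by_contra hν
  obtain ⟨u, v, w, hu, hEu, hEv, hEw⟩ := h.exists_chain_three (by omega)
  exact hu (mulVec_eq_zero_of_infinite_chain hE hR hJ hEu hEv hEw)

/-! ### Equivalent pencils -/

section Equivalence

variable {ι ι' : Type} [Fintype ι] [DecidableEq ι] [Fintype ι'] [DecidableEq ι']
  {E A L Z : Matrix ι ι ℂ} {m : ℕ} {b : Fin m → KroneckerBlock}

theorem inv_mul_mul_mul_inv (hL : IsUnit L) (hZ : IsUnit Z) (M : Matrix ι ι ℂ) :
    L⁻¹ * (L * M * Z) * Z⁻¹ = M := by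
  rw [Matrix.mul_assoc, Matrix.mul_nonsing_inv_cancel_right _ _ ((isUnit_iff_isUnit_det _).1 hZ),
    Matrix.nonsing_inv_mul_cancel_left _ _ ((isUnit_iff_isUnit_det _).1 hL)]

theorem isKroneckerForm_mul_iff (hL : IsUnit L) (hZ : IsUnit Z) :
    IsKroneckerForm (L * E * Z) (L * A * Z) b ↔ IsKroneckerForm E A b := by
  refine ⟨fun h => ⟨h.1, HasKroneckerBlocks.of_mul hL hZ h.2⟩, fun h => ⟨h.1, ?_⟩⟩
  refine HasKroneckerBlocks.of_mul (isUnit_nonsing_inv_iff.2 hL) (isUnit_nonsing_inv_iff.2 hZ) ?_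
  rw [inv_mul_mul_mul_inv hL hZ, inv_mul_mul_mul_inv hL hZ]
  exact h.2

theorem isKroneckerForm_reindex_iff (e : ι ≃ ι') :
    IsKroneckerForm (reindex e e E) (reindex e e A) b ↔ IsKroneckerForm E A b := by
  refine ⟨fun h => ⟨h.1, HasKroneckerBlocks.of_submatrix e.symm e.symm h.2⟩, fun h => ⟨h.1, ?_⟩⟩
  refine HasKroneckerBlocks.of_submatrix e e ?_
  rw [reindex_apply, reindex_apply, submatrix_submatrix, submatrix_submatrix,
    Equiv.symm_comp_self, submatrix_id_id, submatrix_id_id]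
  exact h.2

theorem isRegularPencil_mul_iff (hL : IsUnit L) (hZ : IsUnit Z) :
    IsRegularPencil (L * E * Z) (L * A * Z) ↔ IsRegularPencil E A := by
  have hL' := ((isUnit_iff_isUnit_det _).1 hL).ne_zero
  have hZ' := ((isUnit_iff_isUnit_det _).1 hZ).ne_zero
  refine exists_congr fun lam => ?_
  have : lam • (L * E * Z) - L * A * Z = L * (lam • E - A) * Z := by
    simp [Matrix.mul_sub, Matrix.sub_mul]
  rw [this, det_mul, det_mul]
  simp [hL', hZ']

theorem isRegularPencil_reindex_iff (e : ι ≃ ι') :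
    IsRegularPencil (reindex e e E) (reindex e e A) ↔ IsRegularPencil E A := by
  refine exists_congr fun lam => ?_
  rw [← det_reindex_self e (lam • E - A)]
  rfl

end Equivalence

/-! ### Arithmetic of five by five block matrices -/

section Blocks

variable {m m' n₁ n₂ n₃ n₄ n₅ : ℕ} {κ : Type}

theorem blockRow_mul_blockRows (M₁ : Matrix (Fin m) (Fin n₁) ℂ) (M₂ : Matrix (Fin m) (Fin n₂) ℂ)
    (M₃ : Matrix (Fin m) (Fin n₃) ℂ) (M₄ : Matrix (Fin m) (Fin n₄) ℂ)
    (M₅ : Matrix (Fin m) (Fin n₅) ℂ) (N₁ : Matrix (Fin n₁) κ ℂ) (N₂ : Matrix (Fin n₂) κ ℂ)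
    (N₃ : Matrix (Fin n₃) κ ℂ) (N₄ : Matrix (Fin n₄) κ ℂ) (N₅ : Matrix (Fin n₅) κ ℂ) :
    blockRow M₁ M₂ M₃ M₄ M₅ * blockRows N₁ N₂ N₃ N₄ N₅
      = M₁ * N₁ + (M₂ * N₂ + (M₃ * N₃ + (M₄ * N₄ + M₅ * N₅))) := by
  simp only [blockRow, blockRows, fromCols_mul_fromRows]

theorem mul_blockRow (M : Matrix (Fin m') (Fin m) ℂ) (M₁ : Matrix (Fin m) (Fin n₁) ℂ)
    (M₂ : Matrix (Fin m) (Fin n₂) ℂ)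
    (M₃ : Matrix (Fin m) (Fin n₃) ℂ) (M₄ : Matrix (Fin m) (Fin n₄) ℂ)
    (M₅ : Matrix (Fin m) (Fin n₅) ℂ) :
    M * blockRow M₁ M₂ M₃ M₄ M₅ = blockRow (M * M₁) (M * M₂) (M * M₃) (M * M₄) (M * M₅) := by
  simp only [blockRow, mul_fromCols]

theorem blockRows_mul {κ' : Type} [Fintype κ] (M : Matrix κ κ' ℂ) (N₁ : Matrix (Fin n₁) κ ℂ)
    (N₂ : Matrix (Fin n₂) κ ℂ)
    (N₃ : Matrix (Fin n₃) κ ℂ) (N₄ : Matrix (Fin n₄) κ ℂ) (N₅ : Matrix (Fin n₅) κ ℂ) :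
    blockRows N₁ N₂ N₃ N₄ N₅ * M = blockRows (N₁ * M) (N₂ * M) (N₃ * M) (N₄ * M) (N₅ * M) := by
  simp only [blockRows, fromRows_mul]

theorem blockRow_add (M₁ N₁ : Matrix (Fin m) (Fin n₁) ℂ) (M₂ N₂ : Matrix (Fin m) (Fin n₂) ℂ)
    (M₃ N₃ : Matrix (Fin m) (Fin n₃) ℂ) (M₄ N₄ : Matrix (Fin m) (Fin n₄) ℂ)
    (M₅ N₅ : Matrix (Fin m) (Fin n₅) ℂ) :
    blockRow M₁ M₂ M₃ M₄ M₅ + blockRow N₁ N₂ N₃ N₄ N₅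
      = blockRow (M₁ + N₁) (M₂ + N₂) (M₃ + N₃) (M₄ + N₄) (M₅ + N₅) := by
  ext i (j | j | j | j | j) <;> rfl

theorem blockRow_neg (M₁ : Matrix (Fin m) (Fin n₁) ℂ) (M₂ : Matrix (Fin m) (Fin n₂) ℂ)
    (M₃ : Matrix (Fin m) (Fin n₃) ℂ) (M₄ : Matrix (Fin m) (Fin n₄) ℂ)
    (M₅ : Matrix (Fin m) (Fin n₅) ℂ) :
    -blockRow M₁ M₂ M₃ M₄ M₅ = blockRow (-M₁) (-M₂) (-M₃) (-M₄) (-M₅) := by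
  ext i (j | j | j | j | j) <;> rfl

theorem blockRow_zero : blockRow (0 : Matrix (Fin m) (Fin n₁) ℂ) (0 : Matrix (Fin m) (Fin n₂) ℂ)
    (0 : Matrix (Fin m) (Fin n₃) ℂ) (0 : Matrix (Fin m) (Fin n₄) ℂ)
    (0 : Matrix (Fin m) (Fin n₅) ℂ) = 0 := by
  ext i (j | j | j | j | j) <;> rfl

theorem blockRow_sub (M₁ N₁ : Matrix (Fin m) (Fin n₁) ℂ) (M₂ N₂ : Matrix (Fin m) (Fin n₂) ℂ)
    (M₃ N₃ : Matrix (Fin m) (Fin n₃) ℂ) (M₄ N₄ : Matrix (Fin m) (Fin n₄) ℂ)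
    (M₅ N₅ : Matrix (Fin m) (Fin n₅) ℂ) :
    blockRow M₁ M₂ M₃ M₄ M₅ - blockRow N₁ N₂ N₃ N₄ N₅
      = blockRow (M₁ - N₁) (M₂ - N₂) (M₃ - N₃) (M₄ - N₄) (M₅ - N₅) := by
  ext i (j | j | j | j | j) <;> rfl

theorem blockRows_sub (M₁ N₁ : Matrix (Fin n₁) κ ℂ) (M₂ N₂ : Matrix (Fin n₂) κ ℂ)
    (M₃ N₃ : Matrix (Fin n₃) κ ℂ) (M₄ N₄ : Matrix (Fin n₄) κ ℂ) (M₅ N₅ : Matrix (Fin n₅) κ ℂ) :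
    blockRows M₁ M₂ M₃ M₄ M₅ - blockRows N₁ N₂ N₃ N₄ N₅
      = blockRows (M₁ - N₁) (M₂ - N₂) (M₃ - N₃) (M₄ - N₄) (M₅ - N₅) := by
  ext (i | i | i | i | i) j <;> rfl

theorem one_eq_blockRows : (1 : Matrix (Blk n₁ n₂ n₃ n₄ n₅) (Blk n₁ n₂ n₃ n₄ n₅) ℂ)
    = blockRows (blockRow 1 0 0 0 0) (blockRow 0 1 0 0 0) (blockRow 0 0 1 0 0)
      (blockRow 0 0 0 1 0) (blockRow 0 0 0 0 1) := by
  ext (i | i | i | i | i) (j | j | j | j | j) <;>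
    simp [blockRows, blockRow, Matrix.one_apply]

namespace Blk

variable (v w : Blk n₁ n₂ n₃ n₄ n₅ → ℂ)

/-- The fifth block component of a partitioned vector. -/
def fif (v : Blk n₁ n₂ n₃ n₄ n₅ → ℂ) : Fin n₅ → ℂ :=
  fun i => v (Sum.inr (Sum.inr (Sum.inr (Sum.inr i))))

theorem ext_iff_blocks {v w : Blk n₁ n₂ n₃ n₄ n₅ → ℂ} : v = w ↔
    fst v = fst w ∧ snd v = snd w ∧ trd v = trd w ∧ fth v = fth w ∧ fif v = fif w := by
  refine ⟨fun h => by simp [h], fun ⟨h1, h2, h3, h4, h5⟩ => ?_⟩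
  ext (i | i | i | i | i)
  · exact congrFun h1 i
  · exact congrFun h2 i
  · exact congrFun h3 i
  · exact congrFun h4 i
  · exact congrFun h5 i

variable [Fintype κ] (N₁ : Matrix (Fin n₁) κ ℂ)
    (N₂ : Matrix (Fin n₂) κ ℂ)
    (N₃ : Matrix (Fin n₃) κ ℂ) (N₄ : Matrix (Fin n₄) κ ℂ) (N₅ : Matrix (Fin n₅) κ ℂ) (u : κ → ℂ)

theorem fst_blockRows : fst (blockRows N₁ N₂ N₃ N₄ N₅ *ᵥ u) = N₁ *ᵥ u := rfl
theorem snd_blockRows : snd (blockRows N₁ N₂ N₃ N₄ N₅ *ᵥ u) = N₂ *ᵥ u := rfl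
theorem trd_blockRows : trd (blockRows N₁ N₂ N₃ N₄ N₅ *ᵥ u) = N₃ *ᵥ u := rfl
theorem fth_blockRows : fth (blockRows N₁ N₂ N₃ N₄ N₅ *ᵥ u) = N₄ *ᵥ u := rfl
theorem fif_blockRows : fif (blockRows N₁ N₂ N₃ N₄ N₅ *ᵥ u) = N₅ *ᵥ u := rfl

theorem blockRow_mulVec (M₁ : Matrix (Fin m) (Fin n₁) ℂ)
    (M₂ : Matrix (Fin m) (Fin n₂) ℂ)
    (M₃ : Matrix (Fin m) (Fin n₃) ℂ) (M₄ : Matrix (Fin m) (Fin n₄) ℂ)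
    (M₅ : Matrix (Fin m) (Fin n₅) ℂ) :
    blockRow M₁ M₂ M₃ M₄ M₅ *ᵥ v
      = M₁ *ᵥ fst v + (M₂ *ᵥ snd v + (M₃ *ᵥ trd v + (M₄ *ᵥ fth v + M₅ *ᵥ fif v))) := by
  simp only [blockRow, fromCols_mulVec]
  rfl

/-- A partitioned vector with given blocks. -/
def mk (v₁ : Fin n₁ → ℂ) (v₂ : Fin n₂ → ℂ) (v₃ : Fin n₃ → ℂ) (v₄ : Fin n₄ → ℂ)
    (v₅ : Fin n₅ → ℂ) : Blk n₁ n₂ n₃ n₄ n₅ → ℂ :=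
  Sum.elim v₁ (Sum.elim v₂ (Sum.elim v₃ (Sum.elim v₄ v₅)))

end Blk

end Blocks

/-! ### The almost Kronecker canonical form of a staircase pencil -/

section AlmostKronecker

variable {n₁ n₂ n₃ n₅ : ℕ}

/-- Block Gaussian elimination in two rounds: first with the pivots `E₂₂` and `A₃₃`, then with the
pivots `K` and `-Kᴴ` of block 4, where `E` vanishes and hence is not disturbed. -/
theorem exists_almostKronecker_transform
    (E₁₁ : Matrix (Fin n₁) (Fin n₁) ℂ) (E₂₁ : Matrix (Fin n₂) (Fin n₁) ℂ)
    (E₂₂ : Matrix (Fin n₂) (Fin n₂) ℂ) (hE₂₂ : E₂₂.IsHermitian) (hu : IsUnit E₂₂)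
    (A₁₁ : Matrix (Fin n₁) (Fin n₁) ℂ) (A₁₂ : Matrix (Fin n₁) (Fin n₂) ℂ)
    (A₁₃ : Matrix (Fin n₁) (Fin n₃) ℂ) (A₂₁ : Matrix (Fin n₂) (Fin n₁) ℂ)
    (A₂₂ : Matrix (Fin n₂) (Fin n₂) ℂ) (A₂₃ : Matrix (Fin n₂) (Fin n₃) ℂ)
    (A₃₁ : Matrix (Fin n₃) (Fin n₁) ℂ) (A₃₂ : Matrix (Fin n₃) (Fin n₂) ℂ)
    (A₃₃ : Matrix (Fin n₃) (Fin n₃) ℂ) (hA : IsUnit A₃₃)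
    (K : Matrix (Fin n₁) (Fin n₁) ℂ) (hK : IsUnit K) :
    ∃ L Z : Matrix (Blk n₁ n₂ n₃ n₁ n₅) (Blk n₁ n₂ n₃ n₁ n₅) ℂ, IsUnit L ∧ IsUnit Z ∧
      L * blockRows (blockRow E₁₁ E₂₁ᴴ 0 0 0) (blockRow E₂₁ E₂₂ 0 0 0) (blockRow 0 0 0 0 0)
        (blockRow 0 0 0 0 0) (blockRow 0 0 0 0 0) * Z
        = blockRows (blockRow (E₁₁ - E₂₁ᴴ * E₂₂⁻¹ * E₂₁) 0 0 0 0) (blockRow 0 E₂₂ 0 0 0)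
          (blockRow 0 0 0 0 0) (blockRow 0 0 0 0 0) (blockRow 0 0 0 0 0) ∧
      L * blockRows (blockRow A₁₁ A₁₂ A₁₃ (-Kᴴ) 0) (blockRow A₂₁ A₂₂ A₂₃ 0 0)
        (blockRow A₃₁ A₃₂ A₃₃ 0 0) (blockRow K 0 0 0 0) (blockRow 0 0 0 0 0) * Z
        = blockRows (blockRow 0 0 0 1 0) (blockRow 0 (A₂₂ - A₂₃ * A₃₃⁻¹ * A₃₂) 0 0 0)
          (blockRow 0 0 1 0 0) (blockRow (-1) 0 0 0 0) (blockRow 0 0 0 0 0) ∧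
      ∀ z, Blk.fst z = 0 → Blk.snd (Z *ᵥ z) = Blk.snd z := by
  have hud := (isUnit_iff_isUnit_det _).1 hu
  have hAd := (isUnit_iff_isUnit_det _).1 hA
  have hKd := (isUnit_iff_isUnit_det _).1 hK
  have hKHd := (isUnit_iff_isUnit_det _).1 hK.star
  change IsUnit (Kᴴ).det at hKHd
  set D := E₂₂⁻¹ * E₂₁ with hD
  set F := A₃₃⁻¹ * A₃₂ with hF
  set G := A₂₃ * A₃₃⁻¹ with hG
  have hED : E₂₂ * D = E₂₁ := Matrix.mul_nonsing_inv_cancel_left _ _ hud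
  have hDE : Dᴴ * E₂₂ = E₂₁ᴴ := by
    have h := congrArg conjTranspose hED
    rwa [conjTranspose_mul, hE₂₂.eq] at h
  have hAF : A₃₃ * F = A₃₂ := Matrix.mul_nonsing_inv_cancel_left _ _ hAd
  have hGA : G * A₃₃ = A₂₃ := Matrix.nonsing_inv_mul_cancel_right _ _ hAd
  have hAA := Matrix.mul_nonsing_inv _ hAd
  have hAA' := Matrix.nonsing_inv_mul _ hAd
  have hKK := Matrix.nonsing_inv_mul _ hKd
  have hKK' := Matrix.mul_nonsing_inv _ hKd
  have hKH := Matrix.mul_nonsing_inv _ hKHd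
  -- First round: `D` and `Dᴴ` split off `E₂₁` by a congruence, `F` and `G` remove `A₃₂` and `A₂₃`.
  -- `L₁` also scales `A₃₃` to `1` and `K` to `-1`.
  let Z₁ : Matrix (Blk n₁ n₂ n₃ n₁ n₅) (Blk n₁ n₂ n₃ n₁ n₅) ℂ :=
    blockRows (blockRow 1 0 0 0 0) (blockRow (-D) 1 0 0 0) (blockRow 0 (-F) 1 0 0)
      (blockRow 0 0 0 1 0) (blockRow 0 0 0 0 1)
  let Z₁' : Matrix (Blk n₁ n₂ n₃ n₁ n₅) (Blk n₁ n₂ n₃ n₁ n₅) ℂ :=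
    blockRows (blockRow 1 0 0 0 0) (blockRow D 1 0 0 0) (blockRow (F * D) F 1 0 0)
      (blockRow 0 0 0 1 0) (blockRow 0 0 0 0 1)
  let L₁ : Matrix (Blk n₁ n₂ n₃ n₁ n₅) (Blk n₁ n₂ n₃ n₁ n₅) ℂ :=
    blockRows (blockRow 1 (-Dᴴ) 0 0 0) (blockRow 0 1 (-G) 0 0) (blockRow 0 0 A₃₃⁻¹ 0 0)
      (blockRow 0 0 0 (-K⁻¹) 0) (blockRow 0 0 0 0 1)
  let L₁' : Matrix (Blk n₁ n₂ n₃ n₁ n₅) (Blk n₁ n₂ n₃ n₁ n₅) ℂ :=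
    blockRows (blockRow 1 Dᴴ (Dᴴ * A₂₃) 0 0) (blockRow 0 1 A₂₃ 0 0) (blockRow 0 0 A₃₃ 0 0)
      (blockRow 0 0 0 (-K) 0) (blockRow 0 0 0 0 1)
  have hZ₁ : IsUnit Z₁ := by
    refine IsUnit.of_mul_eq_one_right Z₁' ?_
    rw [one_eq_blockRows]
    simp [Z₁, Z₁', blockRows_mul, blockRow_mul_blockRows, mul_blockRow, blockRow_add]
  have hL₁ : IsUnit L₁ := by
    refine IsUnit.of_mul_eq_one_right L₁' ?_
    rw [one_eq_blockRows]
    simp [L₁, L₁', blockRows_mul, blockRow_mul_blockRows, mul_blockRow, blockRow_add, blockRow_neg, hAA, hKK',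
      Matrix.mul_assoc, hG]
  -- The entries that the first round leaves in block row 1 and block column 1 of `A`.
  set P₁ := A₁₁ - A₁₂ * D - Dᴴ * (A₂₁ - A₂₂ * D) with hP₁
  set P₂ := A₁₂ - A₁₃ * F - Dᴴ * (A₂₂ - A₂₃ * F) with hP₂
  set P₃ := A₁₃ - Dᴴ * A₂₃ with hP₃
  set Q := A₂₁ - A₂₂ * D - G * (A₃₁ - A₃₂ * D) with hQ
  set S := A₃₃⁻¹ * (A₃₁ - A₃₂ * D) with hS
  set H := (Kᴴ)⁻¹ with hH
  -- Second round: `-Kᴴ` in column 4 clears the rest of row 1 and is scaled to `1`; then `L₂` uses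
  -- the `-1` in row 4 to clear column 1.
  let Z₂ : Matrix (Blk n₁ n₂ n₃ n₁ n₅) (Blk n₁ n₂ n₃ n₁ n₅) ℂ :=
    blockRows (blockRow 1 0 0 0 0) (blockRow 0 1 0 0 0) (blockRow 0 0 1 0 0)
      (blockRow 0 (H * P₂) (H * P₃) (-H) 0) (blockRow 0 0 0 0 1)
  let Z₂' : Matrix (Blk n₁ n₂ n₃ n₁ n₅) (Blk n₁ n₂ n₃ n₁ n₅) ℂ :=
    blockRows (blockRow 1 0 0 0 0) (blockRow 0 1 0 0 0) (blockRow 0 0 1 0 0)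
      (blockRow 0 P₂ P₃ (-Kᴴ) 0) (blockRow 0 0 0 0 1)
  let L₂ : Matrix (Blk n₁ n₂ n₃ n₁ n₅) (Blk n₁ n₂ n₃ n₁ n₅) ℂ :=
    blockRows (blockRow 1 0 0 P₁ 0) (blockRow 0 1 0 Q 0) (blockRow 0 0 1 S 0)
      (blockRow 0 0 0 1 0) (blockRow 0 0 0 0 1)
  let L₂' : Matrix (Blk n₁ n₂ n₃ n₁ n₅) (Blk n₁ n₂ n₃ n₁ n₅) ℂ :=
    blockRows (blockRow 1 0 0 (-P₁) 0) (blockRow 0 1 0 (-Q) 0) (blockRow 0 0 1 (-S) 0)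
      (blockRow 0 0 0 1 0) (blockRow 0 0 0 0 1)
  have hZ₂ : IsUnit Z₂ := by
    refine IsUnit.of_mul_eq_one_right Z₂' ?_
    rw [one_eq_blockRows]
    simp [Z₂, Z₂', blockRows_mul, blockRow_mul_blockRows, mul_blockRow, blockRow_add, blockRow_neg,
      ← Matrix.mul_assoc, hKH]
  have hL₂ : IsUnit L₂ := by
    refine IsUnit.of_mul_eq_one_right L₂' ?_
    rw [one_eq_blockRows]
    simp [L₂, L₂', blockRows_mul, blockRow_mul_blockRows, mul_blockRow, blockRow_add, blockRow_neg]
  have h1 : L₁ * blockRows (blockRow E₁₁ E₂₁ᴴ 0 0 0) (blockRow E₂₁ E₂₂ 0 0 0) (blockRow 0 0 0 0 0)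
        (blockRow 0 0 0 0 0) (blockRow 0 0 0 0 0) * Z₁
        = blockRows (blockRow (E₁₁ - E₂₁ᴴ * E₂₂⁻¹ * E₂₁) 0 0 0 0) (blockRow 0 E₂₂ 0 0 0)
          (blockRow 0 0 0 0 0) (blockRow 0 0 0 0 0) (blockRow 0 0 0 0 0) := by
    rw [Matrix.mul_assoc]
    simp [L₁, Z₁, blockRows_mul, blockRow_mul_blockRows, mul_blockRow, blockRow_add, blockRow_neg, blockRow_zero, hED, hDE]
    simp [hD, sub_eq_add_neg, Matrix.mul_assoc]
  have h2 : L₁ * blockRows (blockRow A₁₁ A₁₂ A₁₃ (-Kᴴ) 0) (blockRow A₂₁ A₂₂ A₂₃ 0 0)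
        (blockRow A₃₁ A₃₂ A₃₃ 0 0) (blockRow K 0 0 0 0) (blockRow 0 0 0 0 0) * Z₁
        = blockRows (blockRow P₁ P₂ P₃ (-Kᴴ) 0) (blockRow Q (A₂₂ - A₂₃ * A₃₃⁻¹ * A₃₂) 0 0 0)
          (blockRow S 0 1 0 0) (blockRow (-1) 0 0 0 0) (blockRow 0 0 0 0 0) := by
    rw [Matrix.mul_assoc]
    simp [L₁, Z₁, blockRows_mul, blockRow_mul_blockRows, mul_blockRow, blockRow_add, blockRow_neg, blockRow_zero, hAF, hGA,
      hAA', hKK]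
    simp [hP₁, hP₂, hP₃, hQ, hS, hF, Matrix.mul_assoc, sub_eq_add_neg]
  refine ⟨L₂ * L₁, Z₁ * Z₂, hL₂.mul hL₁, hZ₁.mul hZ₂, ?_, ?_, ?_⟩
  · rw [show ∀ M, L₂ * L₁ * M * (Z₁ * Z₂) = L₂ * (L₁ * M * Z₁) * Z₂ from
      fun M => by simp only [Matrix.mul_assoc], h1]
    simp [L₂, Z₂, blockRows_mul, blockRow_mul_blockRows, mul_blockRow, blockRow_zero]
  · rw [show ∀ M, L₂ * L₁ * M * (Z₁ * Z₂) = L₂ * (L₁ * M * Z₁) * Z₂ from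
      fun M => by simp only [Matrix.mul_assoc], h2]
    simp [L₂, Z₂, blockRows_mul, blockRow_mul_blockRows, mul_blockRow, blockRow_add, blockRow_neg, blockRow_zero,
      ← Matrix.mul_assoc, hKH, hG]
  -- The second block row of `Z₁ * Z₂` is `(-D, 1, 0, 0, 0)`.
  · intro z hz
    rw [← mulVec_mulVec, Blk.snd_blockRows, Blk.blockRow_mulVec, Blk.fst_blockRows,
      Blk.snd_blockRows, Blk.blockRow_mulVec, Blk.blockRow_mulVec]
    simp [hz]

end AlmostKronecker

/-! ### Eigenvectors and finite eigenvalues when `E` is invertible -/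

theorem eq_of_jordanBlock_mulVec {s : ℕ} {lam mu : ℂ} {u : Fin s → ℂ} (hu : u ≠ 0)
    (h : jordanBlock s mu *ᵥ u = lam • u) : mu = lam := by
  have h1 : jordanBlock s (mu - lam) *ᵥ u = 0 := by
    have : jordanBlock s (mu - lam) = jordanBlock s mu - lam • (1 : Matrix (Fin s) (Fin s) ℂ) := by
      ext i j
      by_cases hij : j = i
      · simp [jordanBlock, hij]
      · simp [jordanBlock, hij, eq_comm (a := i)]
    rw [this, sub_mulVec, h, smul_mulVec, one_mulVec, sub_self]
  have h2 : (jordanBlock s (mu - lam)).det = 0 := Matrix.exists_mulVec_eq_zero_iff.1 ⟨u, hu, h1⟩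
  have h3 : (jordanBlock s (mu - lam)).IsUpperTriangular := by
    intro i j hij
    have h4 : j < i := hij
    have h5 : ¬ j = i := h4.ne
    have h6 : ¬ j.val = i.val + 1 := by have := Fin.lt_def.1 h4; omega
    simp [jordanBlock, h5, h6]
  rw [Matrix.det_of_isUpperTriangular h3, Finset.prod_eq_zero_iff] at h2
  obtain ⟨i, -, hi⟩ := h2
  simp only [jordanBlock, of_apply, if_true] at hi
  exact sub_eq_zero.1 hi

/-- With `E` invertible there is a form with finite blocks only. Some block projection of `v` is
nonzero and is an eigenvector of that Jordan block, so the block belongs to `lam`. -/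
theorem isFiniteEigenvalue_of_mulVec {n : ℕ} {E A : Matrix (Fin n) (Fin n) ℂ} (hE : IsUnit E)
    {lam : ℂ} {v : Fin n → ℂ} (hv : v ≠ 0) (h : A *ᵥ v = lam • (E *ᵥ v)) :
    IsFiniteEigenvalue E A lam := by
  obtain ⟨m, b, hb, hfin⟩ := exists_hasKroneckerBlocks_of_isUnit E A hE
  obtain ⟨U, V, hU, hUV⟩ := hb.exists_projections
  obtain ⟨k, hk⟩ : ∃ k, U k *ᵥ v ≠ 0 := by
    by_contra! hcon
    exact hv (hU v hcon)
  obtain ⟨s, mu, hs⟩ := hfin k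
  have h1 : (b k).matA *ᵥ (U k *ᵥ v) = lam • ((b k).matE *ᵥ (U k *ᵥ v)) := by
    rw [mulVec_mulVec, mulVec_mulVec, ← (hUV k).1, ← (hUV k).2, ← mulVec_mulVec, h, mulVec_smul,
      mulVec_mulVec]
  have key : ∀ (c : KroneckerBlock) (u : Fin c.cols → ℂ), c = KroneckerBlock.finite s mu → u ≠ 0 →
      c.matA *ᵥ u = lam • (c.matE *ᵥ u) → mu = lam := by
    rintro c u rfl hu h2
    refine eq_of_jordanBlock_mulVec (s := s) (u := u) hu (h2.trans ?_)
    exact congrArg _ (one_mulVec (m := Fin s) u)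
  exact ⟨m, b, hb, k, s, by rw [hs, key (b k) _ hs hk h1]⟩

/-! ### Structure of pencils in almost Kronecker form -/

namespace IsAlmostKroneckerForm

variable {n₁ n₂ n₃ n₅ : ℕ} {E A : Matrix (Blk n₁ n₂ n₃ n₁ n₅) (Blk n₁ n₂ n₃ n₁ n₅) ℂ}
  {E₁₁ : Matrix (Fin n₁) (Fin n₁) ℂ} {E₂₂ A₂₂ : Matrix (Fin n₂) (Fin n₂) ℂ}
  {v w : Blk n₁ n₂ n₃ n₁ n₅ → ℂ}

/-- This one equation serves the DAE (`w` the derivative), chains at infinity, and eigenvectors (`w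
= lam • v`). -/
theorem mulVec_eq_iff (h : IsAlmostKroneckerForm E A E₁₁ E₂₂ A₂₂) :
    E *ᵥ w = A *ᵥ v ↔ E₁₁ *ᵥ Blk.fst w = Blk.fth v ∧ E₂₂ *ᵥ Blk.snd w = A₂₂ *ᵥ Blk.snd v ∧
      Blk.trd v = 0 ∧ Blk.fst v = 0 := by
  rw [h.eqE, h.eqA, Blk.ext_iff_blocks]
  simp [Blk.fst_blockRows, Blk.snd_blockRows, Blk.trd_blockRows, Blk.fth_blockRows,
    Blk.fif_blockRows, Blk.blockRow_mulVec, eq_comm (a := (0 : Fin n₁ → ℂ)),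
    eq_comm (a := (0 : Fin n₃ → ℂ)), neg_mulVec]

theorem mulVec_E_eq_zero_iff (h : IsAlmostKroneckerForm E A E₁₁ E₂₂ A₂₂) :
    E *ᵥ v = 0 ↔ Blk.fst v = 0 ∧ Blk.snd v = 0 := by
  rw [h.eqE, Blk.ext_iff_blocks]
  simp only [Blk.fst_blockRows, Blk.snd_blockRows, Blk.trd_blockRows, Blk.fth_blockRows,
    Blk.fif_blockRows, Blk.blockRow_mulVec, zero_mulVec, add_zero, zero_add]
  have h1 : E₁₁ *ᵥ Blk.fst v = 0 ↔ Blk.fst v = 0 :=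
    ⟨fun h0 => Matrix.mulVec_injective_iff_isUnit.2 h.posDef₁₁.isUnit (by rw [h0, mulVec_zero]),
      fun h0 => by rw [h0, mulVec_zero]⟩
  have h2 : E₂₂ *ᵥ Blk.snd v = 0 ↔ Blk.snd v = 0 :=
    ⟨fun h0 => Matrix.mulVec_injective_iff_isUnit.2 h.posDef₂₂.isUnit (by rw [h0, mulVec_zero]),
      fun h0 => by rw [h0, mulVec_zero]⟩
  refine Iff.trans ?_ (and_congr h1 h2)
  exact ⟨fun h => ⟨h.1, h.2.1⟩, fun h => ⟨h.1, h.2, rfl, rfl, rfl⟩⟩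

theorem mulVec_eq_smul (h : IsAlmostKroneckerForm E A E₁₁ E₂₂ A₂₂) {lam : ℂ} (hE : E *ᵥ v ≠ 0)
    (hv : A *ᵥ v = lam • (E *ᵥ v)) :
    Blk.snd v ≠ 0 ∧ A₂₂ *ᵥ Blk.snd v = lam • (E₂₂ *ᵥ Blk.snd v) := by
  rw [← mulVec_smul] at hv
  obtain ⟨-, h2, -, h1⟩ := h.mulVec_eq_iff.1 hv.symm
  constructor
  · exact fun h0 => hE (h.mulVec_E_eq_zero_iff.2 ⟨h1, h0⟩)
  · rw [← h2, ← mulVec_smul]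
    rfl

theorem exists_ker_iff (h : IsAlmostKroneckerForm E A E₁₁ E₂₂ A₂₂) (h₅ : n₅ = 0) :
    (∃ v, v ≠ 0 ∧ E *ᵥ v = 0) ↔ 0 < n₁ ∨ 0 < n₃ := by
  constructor
  · rintro ⟨v, hv, hEv⟩
    obtain ⟨h1, h2⟩ := h.mulVec_E_eq_zero_iff.1 hEv
    by_contra! hcon
    obtain rfl : n₁ = 0 := by omega
    obtain rfl : n₃ = 0 := by omega
    subst h₅
    exact hv (Blk.ext_iff_blocks.2 ⟨h1, h2, Subsingleton.elim _ _, Subsingleton.elim _ _,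
      Subsingleton.elim _ _⟩)
  · rintro (h1 | h3)
    · refine ⟨Blk.mk 0 0 0 1 0, fun h0 => ?_, h.mulVec_E_eq_zero_iff.2 ⟨rfl, rfl⟩⟩
      have : (1 : Fin n₁ → ℂ) = 0 := (Blk.ext_iff_blocks.1 h0).2.2.2.1
      simpa using congrFun this ⟨0, h1⟩
    · refine ⟨Blk.mk 0 0 1 0 0, fun h0 => ?_, h.mulVec_E_eq_zero_iff.2 ⟨rfl, rfl⟩⟩
      have : (1 : Fin n₃ → ℂ) = 0 := (Blk.ext_iff_blocks.1 h0).2.2.1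
      simpa using congrFun this ⟨0, h3⟩

theorem exists_chain_iff (h : IsAlmostKroneckerForm E A E₁₁ E₂₂ A₂₂) (h₅ : n₅ = 0) :
    (∃ v w, v ≠ 0 ∧ E *ᵥ v = 0 ∧ E *ᵥ w = A *ᵥ v) ↔ 0 < n₁ := by
  constructor
  · rintro ⟨v, w, hv, hEv, hEw⟩
    obtain ⟨h1, h2⟩ := h.mulVec_E_eq_zero_iff.1 hEv
    obtain ⟨-, -, h3, -⟩ := h.mulVec_eq_iff.1 hEw
    by_contra! hcon
    obtain rfl : n₁ = 0 := by omega
    subst h₅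
    exact hv (Blk.ext_iff_blocks.2 ⟨h1, h2, h3, Subsingleton.elim _ _, Subsingleton.elim _ _⟩)
  · intro h1
    -- A vector `v` supported in block 4 lies in the kernel of `E`, and `A` moves it into block 1,
    -- where the invertible `E₁₁` reaches it.
    obtain ⟨u, hu⟩ := Matrix.mulVec_surjective_iff_isUnit.2 h.posDef₁₁.isUnit 1
    refine ⟨Blk.mk 0 0 0 1 0, Blk.mk u 0 0 0 0, fun h0 => ?_,
      h.mulVec_E_eq_zero_iff.2 ⟨rfl, rfl⟩, h.mulVec_eq_iff.2 ⟨hu, ?_, rfl, rfl⟩⟩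
    · have : (1 : Fin n₁ → ℂ) = 0 := (Blk.ext_iff_blocks.1 h0).2.2.2.1
      simpa using congrFun this ⟨0, h1⟩
    · change E₂₂ *ᵥ 0 = A₂₂ *ᵥ 0
      rw [mulVec_zero, mulVec_zero]

/-- The rearrangement of the five blocks in the order `1, 4, 2, 3, 5`. -/
def blockPerm (n₁ n₂ n₃ n₅ : ℕ) :
    (Fin n₁ ⊕ Fin n₁) ⊕ (Fin n₂ ⊕ (Fin n₃ ⊕ Fin n₅)) ≃ Blk n₁ n₂ n₃ n₁ n₅ where
  toFun := Sum.elim (Sum.elim Sum.inl fun i => Sum.inr (Sum.inr (Sum.inr (Sum.inl i))))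
    (Sum.elim (fun i => Sum.inr (Sum.inl i)) (Sum.elim (fun i => Sum.inr (Sum.inr (Sum.inl i)))
      fun i => Sum.inr (Sum.inr (Sum.inr (Sum.inr i)))))
  invFun := Sum.elim (fun i => Sum.inl (Sum.inl i)) (Sum.elim (fun i => Sum.inr (Sum.inl i))
    (Sum.elim (fun i => Sum.inr (Sum.inr (Sum.inl i))) (Sum.elim (fun i => Sum.inl (Sum.inr i))
      fun i => Sum.inr (Sum.inr (Sum.inr i)))))
  left_inv := by rintro ((i | i) | i | i | i) <;> rfl
  right_inv := by rintro (i | i | i | i | i) <;> rfl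

theorem submatrix_pencil (h : IsAlmostKroneckerForm E A E₁₁ E₂₂ A₂₂) (lam : ℂ) :
    (lam • E - A).submatrix (blockPerm n₁ n₂ n₃ n₅) (blockPerm n₁ n₂ n₃ n₅)
      = fromBlocks (fromBlocks (lam • E₁₁) (-1) 1 0) 0 0
          (fromBlocks (lam • E₂₂ - A₂₂) 0 0 (fromBlocks (-1) 0 0 0)) := by
  rw [h.eqE, h.eqA]
  ext ((i | i) | i | i | i) ((j | j) | j | j | j) <;>
    simp [blockPerm, blockRows, blockRow]

theorem exists_det_eq (h : IsAlmostKroneckerForm E A E₁₁ E₂₂ A₂₂) (h₅ : n₅ = 0) :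
    ∃ c : ℂ, c ≠ 0 ∧ ∀ lam : ℂ, (lam • E - A).det = c * (lam • E₂₂ - A₂₂).det := by
  subst h₅
  let S : Matrix (Fin n₁ ⊕ Fin n₁) (Fin n₁ ⊕ Fin n₁) ℂ := fromBlocks 0 (-1) 1 0
  have hS : S.det ≠ 0 := by
    refine Matrix.det_ne_zero_of_right_inverse (B := fromBlocks 0 1 (-1) 0) ?_
    simp [S, fromBlocks_multiply]
  have hS' : ∀ lam : ℂ, (fromBlocks (lam • E₁₁) (-1 : Matrix (Fin n₁) (Fin n₁) ℂ)
      (1 : Matrix (Fin n₁) (Fin n₁) ℂ) 0).det = S.det := by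
    intro lam
    have : fromBlocks (lam • E₁₁) (-1 : Matrix (Fin n₁) (Fin n₁) ℂ)
        -- All dependence on `lam` sits in a unipotent factor.
        (1 : Matrix (Fin n₁) (Fin n₁) ℂ) 0 = fromBlocks 1 (lam • E₁₁) 0 1 * S := by
      simp [S, fromBlocks_multiply]
    rw [this, det_mul, det_fromBlocks_zero₂₁, det_one, one_mul, one_mul]
  refine ⟨S.det * (-1 : Matrix (Fin n₃) (Fin n₃) ℂ).det, mul_ne_zero hS ?_, fun lam => ?_⟩
  · rw [det_neg, det_one, mul_one]
    exact pow_ne_zero _ (by simp)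
  · rw [← det_submatrix_equiv_self (blockPerm n₁ n₂ n₃ 0), h.submatrix_pencil,
      det_fromBlocks_zero₂₁, hS', det_fromBlocks_zero₂₁, det_fromBlocks_zero₂₁,
      det_isEmpty (A := (0 : Matrix (Fin 0) (Fin 0) ℂ))]
    ring

theorem isRegularPencil_iff (h : IsAlmostKroneckerForm E A E₁₁ E₂₂ A₂₂) :
    IsRegularPencil E A ↔ n₅ = 0 := by
  constructor
  · rintro ⟨lam, hlam⟩
    by_contra h₅
    refine hlam (Matrix.exists_mulVec_eq_zero_iff.1 ⟨Blk.mk 0 0 0 0 1, fun h0 => ?_, ?_⟩)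
    · have : (1 : Fin n₅ → ℂ) = 0 := (Blk.ext_iff_blocks.1 h0).2.2.2.2
      simpa using congrFun this ⟨0, by omega⟩
    · have h1 : E *ᵥ Blk.mk 0 0 0 0 1 = 0 := h.mulVec_E_eq_zero_iff.2 ⟨rfl, rfl⟩
      have h2 : E *ᵥ 0 = A *ᵥ Blk.mk 0 0 0 0 1 :=
        h.mulVec_eq_iff.2 ⟨mulVec_zero _, (mulVec_zero _).trans (mulVec_zero _).symm, rfl, rfl⟩
      rw [sub_mulVec, smul_mulVec, h1, ← h2, mulVec_zero, smul_zero, sub_zero]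
  · intro h₅
    obtain ⟨c, hc, hdet⟩ := h.exists_det_eq h₅
    have hu := (isUnit_iff_isUnit_det _).1 h.posDef₂₂.isUnit
    -- Up to the factor `det E₂₂` the remaining determinant is the characteristic polynomial of
    -- `E₂₂⁻¹ * A₂₂`, which is monic and hence not identically zero.
    obtain ⟨lam, hlam⟩ : ∃ lam, (E₂₂⁻¹ * A₂₂).charpoly.eval lam ≠ 0 := by
      by_contra! hcon
      exact (charpoly_monic (E₂₂⁻¹ * A₂₂)).ne_zero (Polynomial.funext (by simpa using hcon))
    refine ⟨lam, ?_⟩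
    rw [hdet]
    refine mul_ne_zero hc ?_
    have : lam • E₂₂ - A₂₂ = E₂₂ * (scalar (Fin n₂) lam - E₂₂⁻¹ * A₂₂) := by
      rw [Matrix.mul_sub, Matrix.mul_nonsing_inv_cancel_left _ _ hu, scalar_apply,
        ← smul_one_eq_diagonal, Matrix.mul_smul, Matrix.mul_one]
    rw [this, det_mul, ← eval_charpoly]
    exact mul_ne_zero hu.ne_zero hlam

theorem exists_isKroneckerForm (h : IsAlmostKroneckerForm E A E₁₁ E₂₂ A₂₂) {m : ℕ}
    {b : Fin m → KroneckerBlock} (hb : IsKroneckerForm E₂₂ A₂₂ b) :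
    ∃ (m' : ℕ) (b' : Fin m' → KroneckerBlock), IsKroneckerForm E A b' ∧
      ∀ k, ∃ k', b' k' = b k := by
  have hu := (isUnit_iff_isUnit_det _).1 h.posDef₁₁.isUnit
  have h1 : HasKroneckerBlocks (fromBlocks 0 E₁₁ 0 0) (fromBlocks 1 0 0 (-1))
      (fun _ : Fin n₁ => KroneckerBlock.infinite 2) := by
    refine HasKroneckerBlocks.of_mul (L := fromBlocks E₁₁⁻¹ 0 0 (-1)) (Z := fromBlocks E₁₁ 0 0 1)
      (isUnit_fromBlocks_zero₂₁.2 ⟨isUnit_nonsing_inv_iff.2 h.posDef₁₁.isUnit, isUnit_one.neg⟩)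
      (isUnit_fromBlocks_zero₂₁.2 ⟨h.posDef₁₁.isUnit, isUnit_one⟩) ?_
    have := hasKroneckerBlocks_infinite_two n₁
    rw [← fromBlocks_one] at this
    simpa [fromBlocks_multiply, Matrix.nonsing_inv_mul _ hu] using this
  have h2 := h1.fromBlocks (HasKroneckerBlocks.fromBlocks hb.2
    ((hasKroneckerBlocks_infinite_one n₃).fromBlocks (hasKroneckerBlocks_zero n₅)))
  let b' : Fin n₁ ⊕ (Fin m ⊕ (Fin n₃ ⊕ (Fin n₅ ⊕ Fin n₅))) → KroneckerBlock :=
    Sum.elim (fun _ => KroneckerBlock.infinite 2) (Sum.elim b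
      (Sum.elim (fun _ => KroneckerBlock.infinite 1)
        (Sum.elim (fun _ => KroneckerBlock.right 0) fun _ => KroneckerBlock.left 0)))
  have h3 : HasKroneckerBlocks E A b' := by
    -- Interchanging the columns of blocks 1 and 4, but not the rows, turns the coupled pair into
    -- `[0, E₁₁; 0, 0]` and `diag(1, -1)`, the pencil treated in `h1`.
    refine HasKroneckerBlocks.of_submatrix (blockPerm n₁ n₂ n₃ n₅)
      ((Equiv.sumCongr (Equiv.sumComm _ _) (Equiv.refl _)).trans (blockPerm n₁ n₂ n₃ n₅)) ?_
    convert! h2 using 1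
    · rw [h.eqE]
      ext ((i | i) | i | i | i) ((j | j) | j | j | j) <;>
        simp [blockPerm, blockRows, blockRow]
    · rw [h.eqA]
      ext ((i | i) | i | i | i) ((j | j) | j | j | j) <;>
        simp [blockPerm, blockRows, blockRow]
  refine ⟨_, _, h3.isKroneckerForm ?_, fun k => ⟨Fintype.equivFin _ (Sum.inr (Sum.inl k)), ?_⟩⟩
  · rintro (k | k | k | k | k)
    · exact two_pos
    · exact hb.1 k
    · exact one_pos
    · exact trivial
    · exact trivial
  · simp [b']

end IsAlmostKroneckerForm

/-! ### Solutions -/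

section Solutions

variable {ι κ : Type} [Fintype ι] [Fintype κ]

theorem hasDerivWithinAt_linearMap_comp (f : (ι → ℂ) →ₗ[ℂ] (κ → ℂ)) {z : ℝ → ι → ℂ}
    {s : Set ℝ} {t : ℝ} {z' : ι → ℂ} (hz : HasDerivWithinAt z z' s t) :
    HasDerivWithinAt (fun t => f (z t)) (f z') s t :=
  ((f.restrictScalars ℝ).toContinuousLinearMap.hasFDerivAt.comp_hasDerivWithinAt t hz)

theorem contDiffOn_linearMap_comp (f : (ι → ℂ) →ₗ[ℂ] (κ → ℂ)) {z : ℝ → ι → ℂ}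
    {s : Set ℝ} (hz : ContDiffOn ℝ 1 z s) : ContDiffOn ℝ 1 (fun t => f (z t)) s :=
  (f.restrictScalars ℝ).toContinuousLinearMap.contDiff.comp_contDiffOn hz

theorem derivWithin_linearMap_comp (f : (ι → ℂ) →ₗ[ℂ] (κ → ℂ)) {z : ℝ → ι → ℂ}
    (hz : ContDiffOn ℝ 1 z (Set.Ici 0)) {t : ℝ} (ht : 0 ≤ t) :
    derivWithin (fun t => f (z t)) (Set.Ici 0) t = f (derivWithin z (Set.Ici 0) t) :=
  (hasDerivWithinAt_linearMap_comp f
    ((hz.differentiableOn one_ne_zero) t ht).hasDerivWithinAt).derivWithin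
    (uniqueDiffOn_Ici 0 t ht)

theorem derivWithin_mulVec (M : Matrix κ ι ℂ) {z : ℝ → ι → ℂ}
    (hz : ContDiffOn ℝ 1 z (Set.Ici 0)) {t : ℝ} (ht : 0 ≤ t) :
    derivWithin (fun t => M *ᵥ z t) (Set.Ici 0) t = M *ᵥ derivWithin z (Set.Ici 0) t :=
  derivWithin_linearMap_comp M.mulVecLin hz ht

theorem derivWithin_comp_index (g : κ → ι) {z : ℝ → ι → ℂ}
    (hz : ContDiffOn ℝ 1 z (Set.Ici 0)) {t : ℝ} (ht : 0 ≤ t) :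
    derivWithin (fun t => z t ∘ g) (Set.Ici 0) t = derivWithin z (Set.Ici 0) t ∘ g :=
  derivWithin_linearMap_comp (LinearMap.funLeft ℂ ℂ g) hz ht

theorem derivWithin_eq_zero_of_eqOn {z : ℝ → ι → ℂ} (hz : ∀ t, 0 ≤ t → z t = 0) {t : ℝ}
    (ht : 0 ≤ t) : derivWithin z (Set.Ici 0) t = 0 := by
  have h : Set.EqOn z (fun _ => 0) (Set.Ici 0) := fun s hs => hz s hs
  rw [derivWithin_congr h (hz t ht)]
  simp

theorem isSolution_mul_iff [DecidableEq ι] {E A L Z : Matrix ι ι ℂ} (hL : IsUnit L)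
    (hZ : IsUnit Z) (z : ℝ → ι → ℂ) :
    IsSolution (L * E * Z) (L * A * Z) z ↔ IsSolution E A (fun t => Z *ᵥ z t) := by
  have hC : ContDiffOn ℝ 1 (fun t => Z *ᵥ z t) (Set.Ici 0) ↔ ContDiffOn ℝ 1 z (Set.Ici 0) := by
    refine ⟨fun h => ?_, fun h => contDiffOn_linearMap_comp Z.mulVecLin h⟩
    have := contDiffOn_linearMap_comp (Z⁻¹).mulVecLin h
    simpa [mulVec_mulVec, Matrix.nonsing_inv_mul _ ((isUnit_iff_isUnit_det _).1 hZ)] using this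
  unfold IsSolution
  rw [hC]
  refine and_congr_right fun hz => forall_congr' fun t => imp_congr_right fun ht => ?_
  rw [derivWithin_mulVec Z hz ht]
  simp only [← mulVec_mulVec]
  exact (Matrix.mulVec_injective_iff_isUnit.2 hL).eq_iff

theorem isSolution_reindex_iff {E A : Matrix ι ι ℂ} (e : ι ≃ κ) (x : ℝ → ι → ℂ) :
    IsSolution (reindex e e E) (reindex e e A) (fun t => x t ∘ e.symm) ↔ IsSolution E A x := by
  have hC : ContDiffOn ℝ 1 (fun t => x t ∘ e.symm) (Set.Ici 0) ↔
      ContDiffOn ℝ 1 x (Set.Ici 0) := by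
    refine ⟨fun h => ?_, fun h => contDiffOn_linearMap_comp (LinearMap.funLeft ℂ ℂ e.symm) h⟩
    have h1 := contDiffOn_linearMap_comp (LinearMap.funLeft ℂ ℂ e) h
    have h2 : (fun t => LinearMap.funLeft ℂ ℂ e (x t ∘ e.symm)) = x := by
      ext t i
      simp [LinearMap.funLeft_apply]
    rwa [h2] at h1
  unfold IsSolution
  rw [hC]
  refine and_congr_right fun hx => forall_congr' fun t => imp_congr_right fun ht => ?_
  rw [derivWithin_comp_index e.symm hx ht, reindex_apply, reindex_apply,
    submatrix_mulVec_equiv, submatrix_mulVec_equiv]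
  simp only [Equiv.symm_symm, Function.comp_assoc, Equiv.symm_comp_self, Function.comp_id]
  exact e.symm.surjective.injective_comp_right.eq_iff

end Solutions

/-! ### The DAE in almost Kronecker form -/

namespace IsAlmostKroneckerForm

variable {n₁ n₂ n₃ n₅ : ℕ} {E A : Matrix (Blk n₁ n₂ n₃ n₁ n₅) (Blk n₁ n₂ n₃ n₁ n₅) ℂ}
  {E₁₁ : Matrix (Fin n₁) (Fin n₁) ℂ} {E₂₂ A₂₂ : Matrix (Fin n₂) (Fin n₂) ℂ}
  {z : ℝ → Blk n₁ n₂ n₃ n₁ n₅ → ℂ}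

theorem fst_eq_zero (h : IsAlmostKroneckerForm E A E₁₁ E₂₂ A₂₂) (hz : IsSolution E A z) {t : ℝ}
    (ht : 0 ≤ t) : Blk.fst (z t) = 0 :=
  (h.mulVec_eq_iff.1 (hz.2 t ht)).2.2.2

theorem isSolution_iff (h : IsAlmostKroneckerForm E A E₁₁ E₂₂ A₂₂) (h₅ : n₅ = 0) :
    IsSolution E A z ↔ IsSolution E₂₂ A₂₂ (fun t => Blk.snd (z t)) ∧
      ∀ t : ℝ, 0 ≤ t → Blk.fst (z t) = 0 ∧ Blk.trd (z t) = 0 ∧ Blk.fth (z t) = 0 := by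
  constructor
  · intro hz
    have h2 : ∀ t, 0 ≤ t → derivWithin (fun t => Blk.snd (z t)) (Set.Ici 0) t
        = Blk.snd (derivWithin z (Set.Ici 0) t) := fun t ht =>
      derivWithin_comp_index (fun i => Sum.inr (Sum.inl i)) hz.1 ht
    refine ⟨⟨contDiffOn_linearMap_comp
      (LinearMap.funLeft ℂ ℂ fun i => Sum.inr (Sum.inl i)) hz.1, fun t ht => ?_⟩, fun t ht => ?_⟩
    · rw [h2 t ht]
      exact (h.mulVec_eq_iff.1 (hz.2 t ht)).2.1
    · obtain ⟨h4, -, h3, h1⟩ := h.mulVec_eq_iff.1 (hz.2 t ht)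
      -- The hidden constraint: `z₁` vanishes on `[0, ∞)`, hence so does its derivative, and `z₄ =
      -- E₁₁ z₁'` must vanish too.
      have hd : Blk.fst (derivWithin z (Set.Ici 0) t) = 0 := by
        rw [← derivWithin_eq_zero_of_eqOn (fun s hs => h.fst_eq_zero hz hs) ht]
        exact (derivWithin_comp_index (fun i => Sum.inl i) hz.1 ht).symm
      exact ⟨h1, h3, by rw [← h4, hd, mulVec_zero]⟩
  · rintro ⟨⟨hc, hs⟩, h0⟩
    let M : Matrix (Blk n₁ n₂ n₃ n₁ n₅) (Fin n₂) ℂ := blockRows 0 1 0 0 0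
    have hM : ∀ v, Blk.fst (M *ᵥ v) = 0 ∧ Blk.snd (M *ᵥ v) = v ∧ Blk.trd (M *ᵥ v) = 0 ∧
        Blk.fth (M *ᵥ v) = 0 := fun v =>
      ⟨zero_mulVec v, one_mulVec v, zero_mulVec v, zero_mulVec v⟩
    have hz : Set.EqOn z (fun t => M *ᵥ Blk.snd (z t)) (Set.Ici 0) := by
      intro t ht
      obtain ⟨h1, h3, h4⟩ := h0 t ht
      obtain ⟨m1, m2, m3, m4⟩ := hM (Blk.snd (z t))
      subst h₅
      exact Blk.ext_iff_blocks.2 ⟨h1.trans m1.symm, m2.symm, h3.trans m3.symm, h4.trans m4.symm,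
        Subsingleton.elim _ _⟩
    refine ⟨(contDiffOn_linearMap_comp M.mulVecLin hc).congr hz, fun t ht => ?_⟩
    obtain ⟨h1, h3, h4⟩ := h0 t ht
    obtain ⟨m1, m2, -, -⟩ := hM (derivWithin (fun t => Blk.snd (z t)) (Set.Ici 0) t)
    rw [derivWithin_congr hz (hz ht), derivWithin_mulVec M hc ht]
    refine h.mulVec_eq_iff.2 ⟨?_, ?_, h3, h1⟩
    · rw [m1, mulVec_zero, h4]
    · rw [m2]
      exact hs t ht

end IsAlmostKroneckerForm

/-! ### The DAE and the Schur complements in staircase form -/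

namespace StaircaseBlocks

variable {n₁ n₂ n₃ n₅ : ℕ} (B : StaircaseBlocks n₁ n₂ n₃ n₅)

theorem J_sub_R : (B.J - B.R : Matrix (Blk n₁ n₂ n₃ n₁ n₅) (Blk n₁ n₂ n₃ n₁ n₅) ℂ) = blockRows
    (blockRow (B.J₁₁ - B.R₁₁) (-B.J₂₁ᴴ - B.R₂₁ᴴ) (-B.J₃₁ᴴ - B.R₃₁ᴴ) (-B.J₄₁ᴴ) 0)
    (blockRow (B.J₂₁ - B.R₂₁) B.A₂₂ B.A₂₃ 0 0)
    (blockRow (B.J₃₁ - B.R₃₁) B.A₃₂ B.A₃₃ 0 0)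
    (blockRow B.J₄₁ 0 0 0 0)
    (blockRow 0 0 0 0 0) := by
  simp only [J, R, blockRows_sub, blockRow_sub, sub_zero]
  rfl

theorem mulVec_eq_iff (v w : Blk n₁ n₂ n₃ n₁ n₅ → ℂ) :
    B.E *ᵥ w = (B.J - B.R) *ᵥ v ↔
      B.E₁₁ *ᵥ Blk.fst w + B.E₂₁ᴴ *ᵥ Blk.snd w
        = (B.J₁₁ - B.R₁₁) *ᵥ Blk.fst v + ((-B.J₂₁ᴴ - B.R₂₁ᴴ) *ᵥ Blk.snd v
          + ((-B.J₃₁ᴴ - B.R₃₁ᴴ) *ᵥ Blk.trd v + (-B.J₄₁ᴴ) *ᵥ Blk.fth v)) ∧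
      B.E₂₁ *ᵥ Blk.fst w + B.E₂₂ *ᵥ Blk.snd w
        = (B.J₂₁ - B.R₂₁) *ᵥ Blk.fst v + (B.A₂₂ *ᵥ Blk.snd v + B.A₂₃ *ᵥ Blk.trd v) ∧
      0 = (B.J₃₁ - B.R₃₁) *ᵥ Blk.fst v + (B.A₃₂ *ᵥ Blk.snd v + B.A₃₃ *ᵥ Blk.trd v) ∧
      0 = B.J₄₁ *ᵥ Blk.fst v := by
  rw [J_sub_R, E, Blk.ext_iff_blocks]
  simp only [Blk.fst_blockRows, Blk.snd_blockRows, Blk.trd_blockRows, Blk.fth_blockRows,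
    Blk.fif_blockRows, Blk.blockRow_mulVec, zero_mulVec, add_zero, and_true]

/-- With the first blocks zero, the third row is solved for `v₃` by `A₃₃`, the first for `v₄` by
`J₄₁ᴴ`, and substitution in the second row produces the Schur complement. -/
theorem mulVec_eq_iff_of_fst (hA : IsUnit B.A₃₃) (hK : IsUnit B.J₄₁)
    {v w : Blk n₁ n₂ n₃ n₁ n₅ → ℂ} (hv : Blk.fst v = 0) (hw : Blk.fst w = 0) :
    B.E *ᵥ w = (B.J - B.R) *ᵥ v ↔
      B.E₂₂ *ᵥ Blk.snd w = B.hatA₂₂ *ᵥ Blk.snd v ∧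
      Blk.trd v = -((B.A₃₃⁻¹ * B.A₃₂) *ᵥ Blk.snd v) ∧
      Blk.fth v = (B.J₄₁ᴴ)⁻¹ *ᵥ ((-B.J₂₁ᴴ - B.R₂₁ᴴ) *ᵥ Blk.snd v
        + (-B.J₃₁ᴴ - B.R₃₁ᴴ) *ᵥ Blk.trd v - B.E₂₁ᴴ *ᵥ Blk.snd w) := by
  have hAd := (isUnit_iff_isUnit_det _).1 hA
  have hKd : IsUnit (B.J₄₁ᴴ).det := (isUnit_iff_isUnit_det _).1 hK.star
  rw [mulVec_eq_iff, hv, hw]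
  simp only [mulVec_zero, zero_add, and_true]
  have e3 : (0 = B.A₃₂ *ᵥ Blk.snd v + B.A₃₃ *ᵥ Blk.trd v) ↔
      Blk.trd v = -((B.A₃₃⁻¹ * B.A₃₂) *ᵥ Blk.snd v) := by
    constructor
    · intro h
      have h1 := congrArg (fun x => B.A₃₃⁻¹ *ᵥ x) h
      simp only [mulVec_zero, mulVec_add, mulVec_mulVec, Matrix.nonsing_inv_mul _ hAd,
        one_mulVec] at h1
      exact eq_neg_of_add_eq_zero_right h1.symm
    · intro h
      rw [h, mulVec_neg, mulVec_mulVec, Matrix.mul_nonsing_inv_cancel_left _ _ hAd, add_neg_cancel]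
  have e1 : (B.E₂₁ᴴ *ᵥ Blk.snd w = (-B.J₂₁ᴴ - B.R₂₁ᴴ) *ᵥ Blk.snd v
      + ((-B.J₃₁ᴴ - B.R₃₁ᴴ) *ᵥ Blk.trd v + (-B.J₄₁ᴴ) *ᵥ Blk.fth v)) ↔
      Blk.fth v = (B.J₄₁ᴴ)⁻¹ *ᵥ ((-B.J₂₁ᴴ - B.R₂₁ᴴ) *ᵥ Blk.snd v
        + (-B.J₃₁ᴴ - B.R₃₁ᴴ) *ᵥ Blk.trd v - B.E₂₁ᴴ *ᵥ Blk.snd w) := by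
    rw [neg_mulVec]
    constructor
    · intro h
      rw [h]
      have : (-B.J₂₁ᴴ - B.R₂₁ᴴ) *ᵥ Blk.snd v + (-B.J₃₁ᴴ - B.R₃₁ᴴ) *ᵥ Blk.trd v
          - ((-B.J₂₁ᴴ - B.R₂₁ᴴ) *ᵥ Blk.snd v + ((-B.J₃₁ᴴ - B.R₃₁ᴴ) *ᵥ Blk.trd v
            + -(B.J₄₁ᴴ *ᵥ Blk.fth v))) = B.J₄₁ᴴ *ᵥ Blk.fth v := by abel
      rw [this, mulVec_mulVec, Matrix.nonsing_inv_mul _ hKd, one_mulVec]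
    · intro h
      rw [h, mulVec_mulVec, Matrix.mul_nonsing_inv _ hKd, one_mulVec]
      abel
  rw [e1, e3]
  constructor
  · rintro ⟨h1, h2, h3⟩
    refine ⟨?_, h3, h1⟩
    rw [h2, h3, hatA₂₂, sub_mulVec, mulVec_neg, mulVec_mulVec, Matrix.mul_assoc, sub_eq_add_neg]
  · rintro ⟨h2, h3, h1⟩
    refine ⟨h1, ?_, h3⟩
    rw [h2, h3, hatA₂₂, sub_mulVec, mulVec_neg, mulVec_mulVec, Matrix.mul_assoc, sub_eq_add_neg]

theorem fst_eq_zero_of_isSolution (hK : IsUnit B.J₄₁) {y : ℝ → Blk n₁ n₂ n₃ n₁ n₅ → ℂ}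
    (hy : IsSolution B.E (B.J - B.R) y) {t : ℝ} (ht : 0 ≤ t) : Blk.fst (y t) = 0 := by
  have := ((B.mulVec_eq_iff _ _).1 (hy.2 t ht)).2.2.2
  exact Matrix.mulVec_injective_iff_isUnit.2 hK (by rw [← this, mulVec_zero])

theorem isSolution_iff (hA : IsUnit B.A₃₃) (hK : IsUnit B.J₄₁) (hE : IsUnit B.E₂₂) (h₅ : n₅ = 0)
    (y : ℝ → Blk n₁ n₂ n₃ n₁ n₅ → ℂ) :
    IsSolution B.E (B.J - B.R) y ↔
      IsSolution B.E₂₂ B.hatA₂₂ (fun t => Blk.snd (y t)) ∧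
      ∀ t : ℝ, 0 ≤ t →
        Blk.fst (y t) = 0 ∧
        Blk.trd (y t) = -((B.A₃₃⁻¹ * B.A₃₂) *ᵥ Blk.snd (y t)) ∧
        Blk.fth (y t) = (B.J₄₁ᴴ)⁻¹ *ᵥ ((-B.J₂₁ᴴ - B.R₂₁ᴴ) *ᵥ Blk.snd (y t)
          + (-B.J₃₁ᴴ - B.R₃₁ᴴ) *ᵥ Blk.trd (y t)
          - B.E₂₁ᴴ *ᵥ derivWithin (fun s => Blk.snd (y s)) (Set.Ici 0) t) := by
  constructor
  · intro hy
    have h2 : ∀ t, 0 ≤ t → derivWithin (fun t => Blk.snd (y t)) (Set.Ici 0) t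
        = Blk.snd (derivWithin y (Set.Ici 0) t) := fun t ht =>
      derivWithin_comp_index (fun i => Sum.inr (Sum.inl i)) hy.1 ht
    have key : ∀ t : ℝ, 0 ≤ t → _ := fun t ht =>
      (B.mulVec_eq_iff_of_fst hA hK (B.fst_eq_zero_of_isSolution hK hy ht) (by
        rw [← derivWithin_eq_zero_of_eqOn (fun s hs => B.fst_eq_zero_of_isSolution hK hy hs) ht]
        exact (derivWithin_comp_index (fun i => Sum.inl i) hy.1 ht).symm)).1 (hy.2 t ht)
    refine ⟨⟨contDiffOn_linearMap_comp
      (LinearMap.funLeft ℂ ℂ fun i => Sum.inr (Sum.inl i)) hy.1, fun t ht => ?_⟩, fun t ht => ?_⟩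
    · rw [h2 t ht]
      exact (key t ht).1
    · rw [h2 t ht]
      exact ⟨B.fst_eq_zero_of_isSolution hK hy ht, (key t ht).2⟩
  · rintro ⟨⟨hc, hs⟩, h0⟩
    let F := B.A₃₃⁻¹ * B.A₃₂
    -- The formula for `y₄` contains `y₂'`, which is a priori only continuous. The ODE gives `y₂' =
    -- E₂₂⁻¹ Â₂₂ y₂`, so `y` is a constant matrix times `y₂` and therefore continuously
    -- differentiable.
    let M : Matrix (Blk n₁ n₂ n₃ n₁ n₅) (Fin n₂) ℂ := blockRows 0 1 (-F)
      ((B.J₄₁ᴴ)⁻¹ * ((-B.J₂₁ᴴ - B.R₂₁ᴴ) - (-B.J₃₁ᴴ - B.R₃₁ᴴ) * F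
        - B.E₂₁ᴴ * (B.E₂₂⁻¹ * B.hatA₂₂))) 0
    have hy : Set.EqOn y (fun t => M *ᵥ Blk.snd (y t)) (Set.Ici 0) := by
      intro t ht
      obtain ⟨h1, h3, h4⟩ := h0 t ht
      have hd : derivWithin (fun s => Blk.snd (y s)) (Set.Ici 0) t
          = (B.E₂₂⁻¹ * B.hatA₂₂) *ᵥ Blk.snd (y t) := by
        rw [← mulVec_mulVec, ← hs t ht, mulVec_mulVec,
          Matrix.nonsing_inv_mul _ ((isUnit_iff_isUnit_det _).1 hE), one_mulVec]
      subst h₅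
      refine Blk.ext_iff_blocks.2 ⟨h1.trans (zero_mulVec _).symm, (one_mulVec _).symm, ?_, ?_,
        Subsingleton.elim _ _⟩
      · rw [h3, Blk.trd_blockRows, neg_mulVec]
      · rw [h4, Blk.fth_blockRows, h3, hd, ← mulVec_mulVec _ (B.J₄₁ᴴ)⁻¹]
        congr 1
        simp only [sub_mulVec, mulVec_neg, mulVec_mulVec, ← sub_eq_add_neg, F]
    refine ⟨(contDiffOn_linearMap_comp M.mulVecLin hc).congr hy, fun t ht => ?_⟩
    obtain ⟨h1, h34⟩ := h0 t ht
    rw [derivWithin_congr hy (hy ht), derivWithin_mulVec M hc ht]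
    have hsnd : Blk.snd (M *ᵥ derivWithin (fun t => Blk.snd (y t)) (Set.Ici 0) t)
        = derivWithin (fun t => Blk.snd (y t)) (Set.Ici 0) t := one_mulVec _
    refine (B.mulVec_eq_iff_of_fst hA hK h1 (w := M *ᵥ derivWithin (fun t => Blk.snd (y t)) (Set.Ici 0) t)
      (zero_mulVec _)).2 ?_
    rw [hsnd]
    exact ⟨hs t ht, h34⟩

theorem hatA₂₂_eq : B.hatA₂₂ = B.hatJ₂₂ - B.hatR₂₂ := by
  rw [hatJ₂₂, hatR₂₂, skewHermitianPart, hermitianPart, sub_neg_eq_add, ← smul_add]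
  have : B.hatA₂₂ - B.hatA₂₂ᴴ + (B.hatA₂₂ + B.hatA₂₂ᴴ) = (2 : ℂ) • B.hatA₂₂ := by
    rw [two_smul]
    abel
  rw [this, smul_smul]
  norm_num

theorem isSemiDissipative_hatA₂₂
    (hR : (B.R : Matrix (Blk n₁ n₂ n₃ n₁ n₅) (Blk n₁ n₂ n₃ n₁ n₅) ℂ).PosSemidef)
    (hJ : (B.J : Matrix (Blk n₁ n₂ n₃ n₁ n₅) (Blk n₁ n₂ n₃ n₁ n₅) ℂ)ᴴ = -B.J)
    (hA : IsUnit B.A₃₃) : IsSemiDissipative B.hatA₂₂ := by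
  have hAd := (isUnit_iff_isUnit_det _).1 hA
  let g : Fin n₂ ⊕ Fin n₃ → Blk n₁ n₂ n₃ n₁ n₅ :=
    Sum.elim (fun i => Sum.inr (Sum.inl i)) fun i => Sum.inr (Sum.inr (Sum.inl i))
  let R' : Matrix (Fin n₂ ⊕ Fin n₃) (Fin n₂ ⊕ Fin n₃) ℂ := B.R.submatrix g g
  let J' : Matrix (Fin n₂ ⊕ Fin n₃) (Fin n₂ ⊕ Fin n₃) ℂ := B.J.submatrix g g
  have hR' : R'.PosSemidef := hR.submatrix g
  have hJ' : J'ᴴ = -J' := by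
    simp only [J', conjTranspose_submatrix, hJ]
    rfl
  have hJR : J' - R' = fromBlocks B.A₂₂ B.A₂₃ B.A₃₂ B.A₃₃ := by
    ext (i | i) (j | j) <;> rfl
  -- `X` solves the third block row for the third variable, so `(J' - R') * X` has zero lower part
  -- and the congruence by `X` gives `Â₂₂`. As `J'` is skew-Hermitian, the Hermitian part is `-Xᴴ R'
  -- X`.
  let X : Matrix (Fin n₂ ⊕ Fin n₃) (Fin n₂) ℂ := fromRows 1 (-(B.A₃₃⁻¹ * B.A₃₂))
  have hX : Xᴴ * (J' - R') * X = B.hatA₂₂ := by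
    rw [hJR, Matrix.mul_assoc]
    have : fromBlocks B.A₂₂ B.A₂₃ B.A₃₂ B.A₃₃ * X = fromRows B.hatA₂₂ 0 := by
      simp only [X, fromBlocks_mul_fromRows, Matrix.mul_one, Matrix.mul_neg,
        Matrix.mul_nonsing_inv_cancel_left _ _ hAd, add_neg_cancel, hatA₂₂, Matrix.mul_assoc,
        sub_eq_add_neg]
    rw [this]
    simp only [X, conjTranspose_fromRows_eq_fromCols_conjTranspose, fromCols_mul_fromRows,
      conjTranspose_one, Matrix.one_mul, Matrix.mul_zero, add_zero]
  have key : -hermitianPart B.hatA₂₂ = Xᴴ * R' * X := by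
    have h1 : B.hatA₂₂ᴴ = -(Xᴴ * (J' + R') * X) := by
      rw [← hX, conjTranspose_mul, conjTranspose_mul, conjTranspose_conjTranspose,
        conjTranspose_sub, hJ', hR'.isHermitian.eq, ← Matrix.mul_assoc, ← Matrix.neg_mul,
        ← Matrix.mul_neg, neg_add, sub_eq_add_neg]
    have h2 : B.hatA₂₂ + B.hatA₂₂ᴴ = -((2 : ℂ) • (Xᴴ * R' * X)) := by
      rw [h1, ← hX, two_smul]
      simp only [Matrix.mul_sub, Matrix.sub_mul, Matrix.mul_add, Matrix.add_mul]
      abel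
    rw [hermitianPart, h2, smul_neg, neg_neg, smul_smul]
    norm_num
  rw [IsSemiDissipative, key]
  exact hR'.conjTranspose_mul_mul_same X

theorem posDef_E₂₂ (h : (fromBlocks B.E₁₁ B.E₂₁ᴴ B.E₂₁ B.E₂₂).PosDef) : B.E₂₂.PosDef :=
  h.submatrix (e := Sum.inr) Sum.inr_injective

/-- The Schur complement is a congruence of the positive definite leading part by `X`, which is
injective because its upper block is the identity. -/
theorem posDef_hatE₁₁ (h : (fromBlocks B.E₁₁ B.E₂₁ᴴ B.E₂₁ B.E₂₂).PosDef) : B.hatE₁₁.PosDef := by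
  have hud := (isUnit_iff_isUnit_det _).1 (B.posDef_E₂₂ h).isUnit
  let X : Matrix (Fin n₁ ⊕ Fin n₂) (Fin n₁) ℂ := fromRows 1 (-(B.E₂₂⁻¹ * B.E₂₁))
  have h1 : fromBlocks B.E₁₁ B.E₂₁ᴴ B.E₂₁ B.E₂₂ * X = fromRows B.hatE₁₁ 0 := by
    simp only [X, fromBlocks_mul_fromRows, Matrix.mul_one, Matrix.mul_neg,
      Matrix.mul_nonsing_inv_cancel_left _ _ hud, add_neg_cancel, hatE₁₁, Matrix.mul_assoc,
      sub_eq_add_neg]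
  have h2 : Xᴴ * fromBlocks B.E₁₁ B.E₂₁ᴴ B.E₂₁ B.E₂₂ * X = B.hatE₁₁ := by
    rw [Matrix.mul_assoc, h1]
    simp only [X, conjTranspose_fromRows_eq_fromCols_conjTranspose, fromCols_mul_fromRows,
      conjTranspose_one, Matrix.one_mul, Matrix.mul_zero, add_zero]
  rw [← h2]
  refine h.conjTranspose_mul_mul_same fun v w hvw => ?_
  ext i
  have := congrFun hvw (Sum.inl i)
  simpa [X, fromRows_mulVec] using this

theorem exists_isAlmostKroneckerForm (hE : (fromBlocks B.E₁₁ B.E₂₁ᴴ B.E₂₁ B.E₂₂).PosDef)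
    (hA : IsUnit B.A₃₃) (hK : IsUnit B.J₄₁) :
    ∃ L Z : Matrix (Blk n₁ n₂ n₃ n₁ n₅) (Blk n₁ n₂ n₃ n₁ n₅) ℂ, IsUnit L ∧ IsUnit Z ∧
      IsAlmostKroneckerForm (L * B.E * Z) (L * (B.J - B.R) * Z) B.hatE₁₁ B.E₂₂ B.hatA₂₂ ∧
      ∀ z, Blk.fst z = 0 → Blk.snd (Z *ᵥ z) = Blk.snd z := by
  have hE₂₂ := B.posDef_E₂₂ hE
  obtain ⟨L, Z, hL, hZ, h1, h2, h3⟩ := exists_almostKronecker_transform (n₅ := n₅)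
    B.E₁₁ B.E₂₁ B.E₂₂ hE₂₂.isHermitian hE₂₂.isUnit (B.J₁₁ - B.R₁₁) (-B.J₂₁ᴴ - B.R₂₁ᴴ)
    (-B.J₃₁ᴴ - B.R₃₁ᴴ) (B.J₂₁ - B.R₂₁) B.A₂₂ B.A₂₃ (B.J₃₁ - B.R₃₁) B.A₃₂ B.A₃₃ hA B.J₄₁ hK
  refine ⟨L, Z, hL, hZ, ⟨h1, ?_, B.posDef_hatE₁₁ hE, hE₂₂⟩, h3⟩
  rw [J_sub_R]
  exact h2

end StaircaseBlocks

/-! ### Transfer from the almost Kronecker form to the original pencil -/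

theorem mainTheorem5 {n : ℕ} (E J R : Matrix (Fin n) (Fin n) ℂ)
    (hE : E.PosSemidef) (hE0 : E ≠ 0) (hR : R.PosSemidef) (hJ : Jᴴ = -J)
    {n₁ n₂ n₃ n₅ : ℕ} (P : Matrix (Fin n) (Fin n) ℂ) (hP : P ∈ Matrix.unitaryGroup (Fin n) ℂ)
    (e : Fin n ≃ Blk n₁ n₂ n₃ n₁ n₅) (B : StaircaseBlocks n₁ n₂ n₃ n₅)
    (hB : IsStaircaseForm (Matrix.reindex e e (P * E * Pᴴ)) (Matrix.reindex e e (P * J * Pᴴ))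
      (Matrix.reindex e e (P * R * Pᴴ)) B) :
    -- regularity
    (IsRegularPencil E (J - R) ↔ n₅ = 0) ∧
    -- the DAE-index of a regular pencil
    (IsRegularPencil E (J - R) →
      (∃! ν, IsDAEIndex E (J - R) ν) ∧
      ∀ ν, IsDAEIndex E (J - R) ν →
        (ν = 2 ↔ 0 < n₁) ∧ (ν = 1 ↔ n₁ = 0 ∧ 0 < n₃) ∧ (ν = 0 ↔ n₁ = 0 ∧ n₃ = 0)) ∧
    -- passing to staircase form, `y = P x`
    (∀ x : ℝ → Fin n → ℂ,
      IsSolution E (J - R) x ↔ IsSolution B.E (B.J - B.R) (fun t => (P *ᵥ x t) ∘ e.symm)) ∧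
    -- passing to almost Kronecker canonical form, `z = Z⁻¹ y`, and elimination there
    (∀ (L Z : Matrix (Blk n₁ n₂ n₃ n₁ n₅) (Blk n₁ n₂ n₃ n₁ n₅) ℂ)
      (E₁₁ : Matrix (Fin n₁) (Fin n₁) ℂ) (E₂₂ A₂₂ : Matrix (Fin n₂) (Fin n₂) ℂ),
      IsUnit L → IsUnit Z →
      IsAlmostKroneckerForm (L * B.E * Z) (L * (B.J - B.R) * Z) E₁₁ E₂₂ A₂₂ →
      (∀ y : ℝ → Blk n₁ n₂ n₃ n₁ n₅ → ℂ,
        IsSolution B.E (B.J - B.R) y ↔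
          IsSolution (L * B.E * Z) (L * (B.J - B.R) * Z) (fun t => Z⁻¹ *ᵥ y t)) ∧
      (n₅ = 0 → ∀ z : ℝ → Blk n₁ n₂ n₃ n₁ n₅ → ℂ,
        IsSolution (L * B.E * Z) (L * (B.J - B.R) * Z) z ↔
          IsSolution E₂₂ A₂₂ (fun t => Blk.snd (z t)) ∧
          ∀ t : ℝ, 0 ≤ t → Blk.fst (z t) = 0 ∧ Blk.trd (z t) = 0 ∧ Blk.fth (z t) = 0)) ∧
    -- an almost Kronecker canonical form with the Schur complement blocks and with `y₂ = z₂`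
    (∃ L Z : Matrix (Blk n₁ n₂ n₃ n₁ n₅) (Blk n₁ n₂ n₃ n₁ n₅) ℂ,
      IsUnit L ∧ IsUnit Z ∧
      IsAlmostKroneckerForm (L * B.E * Z) (L * (B.J - B.R) * Z) B.hatE₁₁ B.E₂₂ B.hatA₂₂ ∧
      ∀ z : ℝ → Blk n₁ n₂ n₃ n₁ n₅ → ℂ, IsSolution (L * B.E * Z) (L * (B.J - B.R) * Z) z →
        ∀ t : ℝ, 0 ≤ t → Blk.snd (Z *ᵥ z t) = Blk.snd (z t)) ∧
    -- elimination in staircase form, and the underlying implicit ODE for `y₂`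
    (n₅ = 0 → ∀ y : ℝ → Blk n₁ n₂ n₃ n₁ n₅ → ℂ,
      IsSolution B.E (B.J - B.R) y ↔
        IsSolution B.E₂₂ (B.hatJ₂₂ - B.hatR₂₂) (fun t => Blk.snd (y t)) ∧
        ∀ t : ℝ, 0 ≤ t →
          Blk.fst (y t) = 0 ∧
          Blk.trd (y t) = -((B.A₃₃⁻¹ * B.A₃₂) *ᵥ Blk.snd (y t)) ∧
          Blk.fth (y t) = (B.J₄₁ᴴ)⁻¹ *ᵥ ((-B.J₂₁ᴴ - B.R₂₁ᴴ) *ᵥ Blk.snd (y t)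
            + (-B.J₃₁ᴴ - B.R₃₁ᴴ) *ᵥ Blk.trd (y t)
            - B.E₂₁ᴴ *ᵥ derivWithin (fun s => Blk.snd (y s)) (Set.Ici 0) t)) ∧
    (B.E₂₂.PosDef ∧ B.hatA₂₂ = B.hatJ₂₂ - B.hatR₂₂ ∧ IsSemiDissipative B.hatA₂₂) ∧
    -- the finite eigenvalues
    (n₅ = 0 → ∃ c : ℂ, c ≠ 0 ∧
      ∀ lam : ℂ, (lam • E - (J - R)).det = c * (lam • B.E₂₂ - B.hatA₂₂).det) ∧
    (∀ lam : ℂ, IsFiniteEigenvalue E (J - R) lam ↔ IsFiniteEigenvalue B.E₂₂ B.hatA₂₂ lam) ∧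
    (∀ lam : ℂ, IsFiniteEigenvalue E (J - R) lam →
      lam.re ≤ 0 ∧ (lam.re = 0 → IsSemisimpleEigenvalue E (J - R) lam)) := by
  have hPu : IsUnit P := (isUnit_iff_isUnit_det _).2 (UnitaryGroup.det_isUnit ⟨P, hP⟩)
  have hPH : IsUnit Pᴴ := hPu.star
  have hPP : Pᴴ * P = 1 := (Matrix.mem_unitaryGroup_iff').1 hP
  have hA : IsUnit B.A₃₃ := hB.isUnit_A₃₃
  have hK := hB.isUnit_J₄₁
  have hBA : reindex e e (P * (J - R) * Pᴴ) = B.J - B.R := by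
    rw [← hB.eqJ, ← hB.eqR, Matrix.mul_sub, Matrix.sub_mul]
    rfl
  have hE₂₂ := B.posDef_E₂₂ hB.posDef
  have hform : ∀ {m : ℕ} (b : Fin m → KroneckerBlock),
      IsKroneckerForm B.E (B.J - B.R) b ↔ IsKroneckerForm E (J - R) b := by
    intro m b
    rw [← hB.eqE, ← hBA, isKroneckerForm_reindex_iff, isKroneckerForm_mul_iff hPu hPH]
  have hreg : IsRegularPencil B.E (B.J - B.R) ↔ IsRegularPencil E (J - R) := by
    rw [← hB.eqE, ← hBA, isRegularPencil_reindex_iff, isRegularPencil_mul_iff hPu hPH]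
  obtain ⟨L, Z, hL, hZ, hF, hsnd⟩ := B.exists_isAlmostKroneckerForm hB.posDef hA hK
  have hform' : ∀ {m : ℕ} (b : Fin m → KroneckerBlock),
      IsKroneckerForm (L * B.E * Z) (L * (B.J - B.R) * Z) b ↔ IsKroneckerForm E (J - R) b := by
    intro m b
    rw [isKroneckerForm_mul_iff hL hZ, hform]
  have hreg' : IsRegularPencil (L * B.E * Z) (L * (B.J - B.R) * Z) ↔
      IsRegularPencil E (J - R) := by
    rw [isRegularPencil_mul_iff hL hZ, hreg]
  have hindex : ∀ ν, IsDAEIndex E (J - R) ν ↔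
      IsDAEIndex (L * B.E * Z) (L * (B.J - B.R) * Z) ν := fun ν =>
    exists_congr fun m => exists_congr fun b => and_congr_left fun _ => (hform' b).symm
  have hR' : (B.R : Matrix (Blk n₁ n₂ n₃ n₁ n₅) (Blk n₁ n₂ n₃ n₁ n₅) ℂ).PosSemidef := by
    rw [← hB.eqR]
    exact (hR.mul_mul_conjTranspose_same P).submatrix _
  have hJ' : (B.J : Matrix (Blk n₁ n₂ n₃ n₁ n₅) (Blk n₁ n₂ n₃ n₁ n₅) ℂ)ᴴ = -B.J := by
    rw [← hB.eqJ, conjTranspose_reindex, conjTranspose_mul, conjTranspose_mul,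
      conjTranspose_conjTranspose, hJ, Matrix.neg_mul, Matrix.mul_neg, ← Matrix.mul_assoc]
    rfl
  have hregular : IsRegularPencil E (J - R) ↔ n₅ = 0 := by
    rw [← hreg', hF.isRegularPencil_iff]
  refine ⟨hregular, fun hr => ?_, fun x => ?_, fun L' Z' E₁₁ E₂₂ A₂₂ hL' hZ' h => ⟨fun y => ?_,
    fun h₅ z => h.isSolution_iff h₅⟩, ⟨L, Z, hL, hZ, hF, fun z hz t ht =>
    hsnd _ (hF.fst_eq_zero hz ht)⟩, fun h₅ y => ?_, ⟨hE₂₂, B.hatA₂₂_eq,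
    B.isSemiDissipative_hatA₂₂ hR' hJ' hA⟩, fun h₅ => ?_, fun lam => ⟨?_, ?_⟩, ?_⟩
  · have h₅ := hregular.1 hr
    have hν : ∀ ν, IsDAEIndex E (J - R) ν →
        ν ≤ 2 ∧ (1 ≤ ν ↔ 0 < n₁ ∨ 0 < n₃) ∧ (2 ≤ ν ↔ 0 < n₁) := by
      intro ν h
      -- The bound `2` uses the dissipative structure of the original pencil; the two chain criteria
      -- are evaluated on the equivalent almost Kronecker pencil. Together they determine `ν`.
      refine ⟨h.le_two hE hR hJ, ?_, ?_⟩
      · rw [((hindex ν).1 h).one_le_iff (hreg'.2 hr), hF.exists_ker_iff h₅]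
      · rw [((hindex ν).1 h).two_le_iff (hreg'.2 hr), hF.exists_chain_iff h₅]
    obtain ⟨m, b, hb, -⟩ := exists_hasKroneckerBlocks_of_isUnit B.E₂₂ B.hatA₂₂ hE₂₂.isUnit
    obtain ⟨m', b', hb', -⟩ := hF.exists_isKroneckerForm hb
    have hex : IsDAEIndex E (J - R) _ := ⟨m', b', (hform' b').1 hb', rfl⟩
    refine ⟨⟨_, hex, fun ν h => ?_⟩, fun ν h => ?_⟩
    · have h1 := hν ν h
      have h2 := hν _ hex
      omega
    · have h1 := hν ν h
      omega
  · rw [← hB.eqE, ← hBA, isSolution_reindex_iff e fun t => P *ᵥ x t,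
      isSolution_mul_iff hPu hPH]
    simp only [mulVec_mulVec, hPP, one_mulVec]
  · rw [isSolution_mul_iff hL' hZ']
    simp only [mulVec_mulVec, Matrix.mul_nonsing_inv _ ((isUnit_iff_isUnit_det _).1 hZ'),
      one_mulVec]
  · rw [← B.hatA₂₂_eq]
    exact B.isSolution_iff hA hK hE₂₂.isUnit h₅ y
  · obtain ⟨c, hc, hdet⟩ := hF.exists_det_eq h₅
    have hLd := ((isUnit_iff_isUnit_det _).1 hL).ne_zero
    have hZd := ((isUnit_iff_isUnit_det _).1 hZ).ne_zero
    -- Only `L` and `Z` rescale the determinant, since `det Pᴴ * det P = 1` for the unitary `P`.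
    refine ⟨c / (L.det * Z.det), div_ne_zero hc (mul_ne_zero hLd hZd), fun lam => ?_⟩
    have h1 : L * (lam • B.E - (B.J - B.R)) * Z
        = lam • (L * B.E * Z) - L * (B.J - B.R) * Z := by
      simp only [Matrix.mul_sub, Matrix.sub_mul, Matrix.mul_smul, Matrix.smul_mul]
    have h2 : reindex e e (P * (lam • E - (J - R)) * Pᴴ) = lam • B.E - (B.J - B.R) := by
      rw [← hBA, ← hB.eqE, Matrix.mul_sub, Matrix.sub_mul, Matrix.mul_smul, Matrix.smul_mul]
      rfl
    have h3 : (P * (lam • E - (J - R)) * Pᴴ).det = (lam • E - (J - R)).det := by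
      have h4 := congrArg det hPP
      rw [det_mul, det_one] at h4
      rw [det_mul, det_mul]
      linear_combination (lam • E - (J - R)).det * h4
    rw [div_mul_eq_mul_div, eq_div_iff (mul_ne_zero hLd hZd), ← hdet, ← h1, det_mul, det_mul, ← h2,
      det_reindex_self, h3]
    ring
  · rintro ⟨m, b, hb, k, s, hk⟩
    -- One direction passes through an eigenvector, whose second block is an eigenvector of the
    -- reduced pencil. The converse extends a Kronecker form of the reduced pencil, since for
    -- singular pencils eigenvectors alone need not exhibit a finite block.
    obtain ⟨v, hv, hAv⟩ := ((hform' b).2 hb).exists_eigenvector hk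
    obtain ⟨h1, h2⟩ := hF.mulVec_eq_smul hv hAv
    exact isFiniteEigenvalue_of_mulVec hE₂₂.isUnit h1 h2
  · rintro ⟨m, b, hb, k, s, hk⟩
    obtain ⟨m', b', hb', hbb⟩ := hF.exists_isKroneckerForm hb
    obtain ⟨k', hk'⟩ := hbb k
    exact ⟨m', b', (hform' b').1 hb', k', s, hk'.trans hk⟩
  · intro lam hlam
    refine ⟨?_, fun h0 => ⟨hlam, fun m b hb k s hk => hb.size_eq_one hE hR hJ h0 hk⟩⟩
    obtain ⟨m, b, hb, k, s, hk⟩ := hlam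
    exact hb.re_le_zero hE hR hJ hk
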